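/- **Conventions.** Partial orders are non-empty. $\kappa$ is an infinite cardinal. *Systems.* A p.o.w.i.s. (partial order weak inverse system) $\mathfrak s=(J,\langle I_u\rangle_{u\in J},\langle \pi_{u,v}\rangle_{u\le v})$ consists of a directed partial order $J=J^{\mathfrak s}$, partial orders $I_u=I^{\mathfrak s}_u$, and partial maps $\pi_{u,v}=\pi^{\mathfrak s}_{u,v}$ from $I_v$ to $I_u$ (not necessarily order preserving) with $\pi_{u,w}=\pi_{u,v}\circ\pi_{v,w}$, as partial maps, for $u\le v\le w$. It is a $\kappa$-p.o.w.i.s. if $|J|\le\kappa$ and $|I_u|\le\kappa$ for all $u$. For a partial order $I$ let $\mathrm{rk}_I:I\to\mathrm{Ord}\cup\{\infty\}$ be given by $\mathrm{rk}_I(t)\ge\alpha$ iff for every $\beta<\alpha$ there is $s<t$ with $\mathrm{rk}_I(s)\ge\beta$. Let $\mathrm{rk}^{<\infty}_I(t)$ be $\mathrm{rk}_I(t)$ if this is $<\infty$, and $\sup\{\mathrm{rk}_I(s)+1: s<t,\ \mathrm{rk}_I(s)<\infty\}$ otherwise. $I$ is non-trivial if $\{s\le t:\mathrm{rk}_I(s)\ge\beta\}$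 is infinite whenever $t\in I$ and $\beta<\mathrm{rk}^{<\infty}_I(t)$; a p.o.w.i.s. is non-trivial if all its $I_u$ are. *Groups.* For a partial order $I$ let $X_I$ be the set of pairs $x=(\bar t,\eta)$ where, for some $n=n(x)<\omega$, $\bar t=\langle t_0,\dots,t_n\rangle$ is strictly decreasing in $I$ and $\eta:\{0,\dots,n-1\}\to\{0,1\}$; for $m\le n(x)$ let $x{\upharpoonleft}m=(\langle t_0,\dots,t_m\rangle,\eta{\restriction}m)$. $G_I$ is the group generated by $\{g_x:x\in X_I\}$ freely except for the relations: $g_x^{-1}=g_x$; $g_{y_1}g_{y_2}=g_{y_2}g_{y_1}$ if $n(y_1)=n(y_2)$; and $g_xg_{y_1}g_x^{-1}=g_{y_2}$ whenever $n(x)<n(y_1)=n(y_2)$, $y_1{\upharpoonleft}n(x)=y_2{\upharpoonleft}n(x)$, $\bar t^{y_1}=\bar t^{y_2}$, and for every $\ell<n(y_1)$: $\eta^{y_1}(\ell)\ne\eta^{y_2}(\ell)$ iff $\ell=n(x)$ and $x=y_1{\upharpoonleft}n(x)$. Let $G^{<0}_I$ be the subgroup generated by those $g_x$ for which $\eta^x$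 takes the value $0$, let $L_I$ be the group generated by elements $h_{a}$ ($a\in G_I/G_I^{<0}$ a left coset) freely except for $h_ah_b=h_bh_a$ and $h_a^{-1}=h_a$, and let $K_I=G_I\ltimes L_I$, where $f\in G_I$ acts on $L_I$ by $h_a\mapsto h_{fa}$. For a p.o.w.i.s. $\mathfrak s$ write $K^{\mathfrak s}_u=K_{I^{\mathfrak s}_u}$, and similarly $G_u$, $L_u$. *Limits.* For $\bar t\in{}^kI$ let $\mathrm{tp}(\bar t,I)$ be its quantifier-free type (which records, for each pair $\ell_1,\ell_2<k$, whether $t_{\ell_1}<t_{\ell_2}$, $t_{\ell_1}=t_{\ell_2}$, $t_{\ell_1}>t_{\ell_2}$ or none of these holds), and let $\mathcal S^k$ be the finite set of all such types of $k$-tuples in all partial orders. A p.o.w.i.s. $\mathfrak s$ is an existential limit of a p.o.w.i.s. $\mathfrak t$, as witnessed by $v_*$, when: (a) $J^{\mathfrak s}=J^{\mathfrak t}\cup\{v_*\}$, $v_*\notin J^{\mathfrak t}$, the order of $J^{\mathfrak s}$ extends that of $J^{\mathfrak t}$, and $v_*$ is the largest element of $J^{\mathfrak s}$; (b) $I^{\mathfrak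 s}_u=I^{\mathfrak t}_u$ and $\pi^{\mathfrak s}_{u,v}=\pi^{\mathfrak t}_{u,v}$ for $u\le v$ in $J^{\mathfrak t}$; (c) for every $x\in I^{\mathfrak s}_{v_*}$, $\pi^{\mathfrak s}_{u,v_*}(x)$ is defined for all large enough $u\in J^{\mathfrak t}$; (d) for all $x,y\in I^{\mathfrak s}_{v_*}$ and all large enough $u\in J^{\mathfrak t}$: $x<y$ iff $\pi^{\mathfrak s}_{u,v_*}(x)<\pi^{\mathfrak s}_{u,v_*}(y)$; (e) if $w\in J^{\mathfrak t}$ and $\langle t_u:w\le u\in J^{\mathfrak t}\rangle$ satisfies $t_u\in I^{\mathfrak t}_u$ and $\pi^{\mathfrak t}_{u_1,u_2}(t_{u_2})=t_{u_1}$ for $w\le u_1\le u_2$, then there is a unique $x\in I^{\mathfrak s}_{v_*}$ with $\pi^{\mathfrak s}_{u,v_*}(x)=t_u$ for all $u\ge w$ in $J^{\mathfrak t}$; (f) whenever $u_*\in J^{\mathfrak t}$, $k_1,k_2<\omega$, $E$ is an equivalence relation on $\mathcal S^{k_1+k_2}$, $e_u$ is an $E$-class for each $u\ge u_*$ in $J^{\mathfrak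 t}$, $\bar t\in{}^{k_1}(I^{\mathfrak s}_{v_*})$, and for every $v\ge u_*$ in $J^{\mathfrak t}$ there is $\bar s_v\in{}^{k_2}(I^{\mathfrak t}_v)$ such that for all $u$ with $u_*\le u\le v$ the tuples $\pi^{\mathfrak s}_{u,v_*}(\bar t)$ and $\pi^{\mathfrak t}_{u,v}(\bar s_v)$ are defined and the type of their concatenation in $I^{\mathfrak t}_u$ lies in $e_u$, then there are $\bar s\in{}^{k_2}(I^{\mathfrak s}_{v_*})$ and $p_*\in\mathcal S^{k_1+k_2}$ such that for all large enough $u\in J^{\mathfrak t}$ the tuple $\pi^{\mathfrak s}_{u,v_*}(\bar t\frown\bar s)$ is defined, its type in $I^{\mathfrak t}_u$ is $p_*$, and $p_*\in e_u$. **Main Claim.** Let $\mathfrak s,\mathfrak t$ be p.o.w.i.s. such that $\mathfrak s$ is an existential limit of $\mathfrak t$ as witnessed by $v_*$. Suppose that $\mathfrak t$ is a non-trivial $\kappa$-p.o.w.i.s. and that $J^{\mathfrak t}$ is linearly ordered and $\aleph_1$-directed (every countable subset has an upper bound). Then $K^{\mathfrak s}_{v_*}=G_{v_*}\ltimes L_{v_*}$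 is an almost $\kappa$-automorphism group; that is, there are a structure $M$ of cardinality at most $\kappa$ (in some language) and a normal subgroup $G^-$ of $\mathrm{Aut}(M)$ of cardinality at most $\kappa$ such that $K^{\mathfrak s}_{v_*}\cong\mathrm{Aut}(M)/G^-$. -/

import Mathlib

universe u

namespace AutTower

/-! ### Ranks in partial orders -/

section Rank

variable {I : Type u} [PartialOrder I]

/-- `RkGE α t` is the relation `rk_I(t) ≥ α`: for every `β < α` there is `s <_I t` with
`rk_I(s) ≥ β`. -/
def RkGE (α : Ordinal.{u}) (t : I) : Prop :=
  ∀ β : Ordinal.{u}, β < α → ∃ s : I, s < t ∧ RkGE β s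
termination_by α

theorem RkGE.anti {α β : Ordinal.{u}} {t : I} (h : RkGE α t) (hβ : β ≤ α) : RkGE β t := by
  rw [RkGE] at h ⊢
  exact fun γ hγ => h γ (hγ.trans_le hβ)

open Classical in
/-- The rank `rk_I : I → Ord ∪ {∞}`, with `∞ = ⊤`. -/
noncomputable def rk (t : I) : WithTop Ordinal.{u} :=
  if ∀ α : Ordinal.{u}, RkGE α t then ⊤
  else ((sSup {α : Ordinal.{u} | RkGE α t} : Ordinal.{u}) : WithTop Ordinal.{u})

/-- The defining property of `rk_I`. -/
theorem coe_le_rk_iff (α : Ordinal.{u}) (t : I) :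
    (α : WithTop Ordinal.{u}) ≤ rk t ↔ RkGE α t := by
  unfold rk
  split_ifs with h
  · simp [h α]
  · push Not at h
    obtain ⟨δ, hδ⟩ := h
    have hb : BddAbove {α : Ordinal.{u} | RkGE α t} := by
      refine ⟨δ, fun γ hγ => ?_⟩
      by_contra hlt
      exact hδ (RkGE.anti hγ (not_le.1 hlt).le)
    rw [WithTop.coe_le_coe]
    constructor
    · intro hα
      rw [RkGE]
      intro β hβ
      obtain ⟨γ, hγ, hβγ⟩ := exists_lt_of_lt_csSup' (hβ.trans_le hα)
      have hγ' : RkGE γ t := hγ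
      rw [RkGE] at hγ'
      exact hγ' β hβγ
    · intro hα
      exact le_csSup hb hα

open Classical in
/-- `rk^{<∞}_I(t)` is `rk_I(t)` if this is an ordinal, and otherwise the supremum of all
`rk_I(s) + 1` with `s <_I t` and `rk_I(s) < ∞`. -/
noncomputable def rkFin (t : I) : Ordinal.{u} :=
  if rk t = ⊤ then ⨆ s : {s : I // s < t ∧ rk s ≠ ⊤}, ((rk s.1).untop s.2.2 + 1)
  else (rk t).untopD 0

end Rank

/-- A partial order `I` is non-trivial when `{s : s ≤ t, rk_I(s) ≥ β}` is infinite for all `t ∈ I`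
and `β < rk^{<∞}_I(t)`. -/
def NonTrivialOrder (I : Type u) [PartialOrder I] : Prop :=
  ∀ (t : I) (β : Ordinal.{u}), β < rkFin t →
    {s : I | s ≤ t ∧ (β : WithTop Ordinal.{u}) ≤ rk s}.Infinite

/-! ### The groups attached to a partial order -/

section Groups

/-- Elements of `X_I`: pairs `(t̄, η)` where `t̄ = ⟨t_0, …, t_n⟩` is strictly decreasing in `I` and
`η : {0, …, n-1} → {0, 1}`. Both are stored as lists. -/
@[ext]
structure X (I : Type u) [PartialOrder I] : Type u where
  t : List I
  η : List (Fin 2)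
  length_eq : t.length = η.length + 1
  decreasing : t.Pairwise (fun a b => b < a)

variable {I : Type u} [PartialOrder I]

/-- The number `n(x)`; the sequence `t̄` has length `n(x) + 1`. -/
def X.n (x : X I) : ℕ := x.η.length

/-- The restriction `x ↿ m` for `m ≤ n(x)`: keep `t_0, …, t_m` and `η(0), …, η(m-1)`. -/
def X.restr (x : X I) (m : ℕ) (hm : m ≤ x.n) : X I where
  t := x.t.take (m + 1)
  η := x.η.take m
  length_eq := by
    have h := x.length_eq
    have hm' : m ≤ x.η.length := hm
    rw [List.length_take, List.length_take]
    omega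
  decreasing := x.decreasing.sublist (List.take_sublist _ _)

/-- The relation `⊛_{x,y₁,y₂}`. -/
def Circ (x y₁ y₂ : X I) : Prop :=
  ∃ (h₁ : x.n < y₁.n) (h₂ : y₁.n = y₂.n),
    y₁.restr x.n h₁.le = y₂.restr x.n (h₂ ▸ h₁.le) ∧
    y₁.t = y₂.t ∧
    ∀ l : ℕ, l < y₁.n →
      (y₁.η[l]? ≠ y₂.η[l]? ↔ l = x.n ∧ x = y₁.restr x.n h₁.le)

/-- The relators of `G_I`: `g_x⁻¹ = g_x`, `g_{y₁} g_{y₂} = g_{y₂} g_{y₁}` if `n(y₁) = n(y₂)`, and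
`g_x g_{y₁} g_x⁻¹ = g_{y₂}` if `⊛_{x,y₁,y₂}`. -/
inductive GRel : FreeGroup (X I) → Prop
  | invol (x : X I) : GRel ((FreeGroup.of x)⁻¹ * (FreeGroup.of x)⁻¹)
  | comm (y₁ y₂ : X I) (h : y₁.n = y₂.n) :
      GRel (FreeGroup.of y₁ * FreeGroup.of y₂ * (FreeGroup.of y₂ * FreeGroup.of y₁)⁻¹)
  | conj (x y₁ y₂ : X I) (h : Circ x y₁ y₂) :
      GRel (FreeGroup.of x * FreeGroup.of y₁ * (FreeGroup.of x)⁻¹ * (FreeGroup.of y₂)⁻¹)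

variable (I)

/-- The group `G_I` generated by `{g_x : x ∈ X_I}` freely except for the relations above. -/
abbrev G : Type u := PresentedGroup {r : FreeGroup (X I) | GRel r}

variable {I} in
/-- The generator `g_x` of `G_I`. -/
def g (x : X I) : G I := PresentedGroup.of x

/-- `G^{<0}_I`, the subgroup of `G_I` generated by the `g_x` such that `η^x` takes the value `0`
(these are the `x` of rank `-1`). -/
def GltZero : Subgroup (G I) := Subgroup.closure {a : G I | ∃ x : X I, (0 : Fin 2) ∈ x.η ∧ a = g x}

/-- The set `𝒜_I` of left cosets of `G^{<0}_I` in `G_I`; `G_I` acts on it by left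
multiplication. -/
abbrev Coset : Type u := G I ⧸ GltZero I

variable {I} in
/-- The relators of `L_I`: `h_a h_b = h_b h_a` and `h_a⁻¹ = h_a`. -/
inductive LRel : FreeGroup (Coset I) → Prop
  | comm (a b : Coset I) :
      LRel (FreeGroup.of a * FreeGroup.of b * (FreeGroup.of b * FreeGroup.of a)⁻¹)
  | invol (a : Coset I) : LRel ((FreeGroup.of a)⁻¹ * (FreeGroup.of a)⁻¹)

/-- The group `L_I` generated by `{h_a : a ∈ 𝒜_I}` freely except for the relations above. -/
abbrev L : Type u := PresentedGroup {r : FreeGroup (Coset I) | LRel r}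

variable {I} in
/-- The generator `h_a` of `L_I`. -/
def h (a : Coset I) : L I := PresentedGroup.of a

theorem h_invol (a : Coset I) : (h a)⁻¹ * (h a)⁻¹ = 1 :=
  PresentedGroup.one_of_mem (LRel.invol a)

theorem h_comm (a b : Coset I) : h a * h b * (h b * h a)⁻¹ = 1 :=
  PresentedGroup.one_of_mem (LRel.comm a b)

/-- The endomorphism of `L_I` with `h_a ↦ h_{f a}`. -/
def actHom (f : G I) : L I →* L I :=
  PresentedGroup.toGroup (f := fun a => h (f • a)) (by
    rintro r (⟨a, b⟩ | ⟨a⟩)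
    · simpa using h_comm I (f • a) (f • b)
    · simpa using h_invol I (f • a))

@[simp]
theorem actHom_h (f : G I) (a : Coset I) : actHom I f (h a) = h (f • a) :=
  PresentedGroup.toGroup.of _

theorem actHom_one : actHom I 1 = MonoidHom.id (L I) := by
  refine PresentedGroup.ext fun a => ?_
  have := actHom_h I 1 a
  rw [one_smul] at this
  exact this

theorem actHom_mul (f f' : G I) : actHom I (f * f') = (actHom I f).comp (actHom I f') := by
  refine PresentedGroup.ext fun a => ?_
  have e₁ := actHom_h I (f * f') a
  have e₂ := actHom_h I f' a
  have e₃ := actHom_h I f (f' • a)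
  rw [mul_smul] at e₁
  rw [← e₂] at e₃
  exact e₁.trans e₃.symm

/-- The homomorphism `𝐡_I : G_I → Aut(L_I)` with `𝐡_I(f)(h_a) = h_{f a}`. -/
def act : G I →* MulAut (L I) where
  toFun f := MonoidHom.toMulEquiv (actHom I f) (actHom I f⁻¹)
    (by rw [← actHom_mul, inv_mul_cancel, actHom_one])
    (by rw [← actHom_mul, mul_inv_cancel, actHom_one])
  map_one' := by
    ext x
    exact DFunLike.congr_fun (actHom_one I) x
  map_mul' f f' := by
    ext x
    exact DFunLike.congr_fun (actHom_mul I f f') x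

theorem act_h (f : G I) (a : Coset I) : act I f (h a) = h (f • a) :=
  actHom_h I f a

/-- The semidirect product `K_I = G_I ⋉ L_I` with respect to `𝐡_I`. -/
abbrev K : Type u := L I ⋊[act I] G I

end Groups

/-! ### Partial order weak inverse systems -/

/-- A p.o.w.i.s. (partial order weak inverse system) `(J, ⟨I_u⟩, ⟨π_{u,v}⟩)`: `J` is a directed
partial order, every `I_u` is a partial order, and `π_{u,v}`, for `u ≤ v`, is a partial map from
`I_v` to `I_u`, not necessarily order preserving, with `π_{u,w} = π_{u,v} ∘ π_{v,w}` as partial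
maps. Partial orders are non-empty. -/
structure Powis : Type (u + 1) where
  J : Type u
  [orderJ : PartialOrder J]
  nonempty_J : Nonempty J
  directed : ∀ u v : J, ∃ w : J, u ≤ w ∧ v ≤ w
  I : J → Type u
  [orderI : ∀ u : J, PartialOrder (I u)]
  nonempty_I : ∀ u : J, Nonempty (I u)
  π : ∀ {u v : J}, u ≤ v → I v → Option (I u)
  π_comp : ∀ {u v w : J} (huv : u ≤ v) (hvw : v ≤ w) (x : I w),
    π (huv.trans hvw) x = (π hvw x).bind (π huv)

attribute [instance] Powis.orderJ Powis.orderI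

namespace Powis

/-- `t` is a `κ`-p.o.w.i.s.: `J` and all the `I_u` have cardinality at most `κ`. -/
def IsKappa (t : Powis.{u}) (κ : Cardinal.{u}) : Prop :=
  Cardinal.mk t.J ≤ κ ∧ ∀ v : t.J, Cardinal.mk (t.I v) ≤ κ

/-- `t` is non-trivial: all the `I_u` are non-trivial. -/
def NonTrivial (t : Powis.{u}) : Prop :=
  ∀ v : t.J, NonTrivialOrder (t.I v)

end Powis

/-- `ℵ₁`-directed: every countable subset has an upper bound. -/
def Aleph1Directed (J : Type u) [PartialOrder J] : Prop :=
  ∀ A : Set J, A.Countable → ∃ b : J, ∀ a ∈ A, a ≤ b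

/-! ### Quantifier free types of finite tuples -/

open Classical in
/-- The quantifier free type of a `k`-tuple in a partial order: the set of all `(ι, l₁, l₂)` such
that `ι = 0` and `t_{l₁} < t_{l₂}`, or `ι = 1` and `t_{l₁} = t_{l₂}`, or `ι = 2` and
`t_{l₁} > t_{l₂}`, or `ι = 3` and none of these. -/
noncomputable def tpqf {I : Type u} [PartialOrder I] {k : ℕ} (t : Fin k → I) :
    Set (Fin 4 × Fin k × Fin k) :=
  {a | a.1 = if t a.2.1 < t a.2.2 then 0 else if t a.2.1 = t a.2.2 then 1
    else if t a.2.1 > t a.2.2 then 2 else 3}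

/-- The set `𝒮^k` of all quantifier free types of `k`-tuples in partial orders. -/
def QfType (k : ℕ) : Type :=
  {p : Set (Fin 4 × Fin k × Fin k) //
    ∃ (I : Type u) (_ : PartialOrder I) (t : Fin k → I), p = tpqf t}

/-- The quantifier free type of a tuple, as an element of `𝒮^k`. -/
noncomputable def tp {I : Type u} [PartialOrder I] {k : ℕ} (t : Fin k → I) : QfType.{u} k :=
  ⟨tpqf t, I, inferInstance, t, rfl⟩

/-! ### Existential limits -/

/-- The identification of `t` with the part of `s` below `v_*`: `J^s` is `J^t` together with one
new element `v_*`, which is its largest element; `I^s_u = I^t_u` for `u ∈ J^t`; and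
`π^s_{u,v} = π^t_{u,v}` for `u ≤ v` in `J^t`. -/
structure Extension (s t : Powis.{u}) (vs : s.J) : Type u where
  j : t.J ↪o s.J
  range_j : Set.range j = {vs}ᶜ
  le_vs : ∀ v : s.J, v ≤ vs
  ι : ∀ v : t.J, t.I v ≃o s.I (j v)
  π_eq : ∀ {v w : t.J} (hvw : v ≤ w) (x : t.I w),
    s.π (j.monotone hvw) (ι w x) = (t.π hvw x).map (ι v)

namespace Extension

variable {s t : Powis.{u}} {vs : s.J} (E : Extension s t vs)

/-- The partial map `π^s_{u,v_*} : I^s_{v_*} → I^s_u = I^t_u` for `u ∈ J^t`. -/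
def proj (v : t.J) (x : s.I vs) : Option (t.I v) :=
  (s.π (E.le_vs (E.j v)) x).map (E.ι v).symm

/-- `s` is the limit of `t`, as witnessed by `v_*`. -/
structure IsLimit : Prop where
  /-- Every element of `I^s_{v_*}` has projections to all large enough `u ∈ J^t`. -/
  dom : ∀ x : s.I vs, ∃ w : t.J, ∀ v : t.J, w ≤ v → ∃ x' : t.I v, E.proj v x = some x'
  /-- The order of two elements of `I^s_{v_*}` is that of their projections to all large enough
  `u ∈ J^t`. -/
  order : ∀ x y : s.I vs, ∃ w : t.J, ∀ v : t.J, w ≤ v →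
    ∃ x' y' : t.I v, E.proj v x = some x' ∧ E.proj v y = some y' ∧ (x < y ↔ x' < y')
  /-- Every coherent sequence on a final segment of `J^t` has a unique limit in `I^s_{v_*}`. -/
  thread : ∀ (w : t.J) (r : ∀ v : t.J, w ≤ v → t.I v),
    (∀ (v₁ v₂ : t.J) (h₁ : w ≤ v₁) (h₁₂ : v₁ ≤ v₂),
      t.π h₁₂ (r v₂ (h₁.trans h₁₂)) = some (r v₁ h₁)) →
    ∃! x : s.I vs, ∀ (v : t.J) (hv : w ≤ v), E.proj v x = some (r v hv)

/-- The additional clause for an existential limit. -/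
def IsExistential : Prop :=
  ∀ (us : t.J) (k₁ k₂ : ℕ) (R : Setoid (QfType.{u} (k₁ + k₂)))
    (e : ∀ v : t.J, us ≤ v → Quotient R) (a : Fin k₁ → s.I vs),
    (∀ v : t.J, us ≤ v → ∃ b : Fin k₂ → t.I v,
      ∀ (w : t.J) (hw : us ≤ w) (hwv : w ≤ v),
        ∃ (a' : Fin k₁ → t.I w) (b' : Fin k₂ → t.I w),
          (∀ i, E.proj w (a i) = some (a' i)) ∧
          (∀ i, t.π hwv (b i) = some (b' i)) ∧
          e w hw = Quotient.mk R (tp (Fin.append a' b'))) →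
    ∃ (b : Fin k₂ → s.I vs) (p : QfType.{u} (k₁ + k₂)) (w₀ : t.J), us ≤ w₀ ∧
      ∀ (w : t.J) (hw : us ≤ w), w₀ ≤ w →
        ∃ (a' : Fin k₁ → t.I w) (b' : Fin k₂ → t.I w),
          (∀ i, E.proj w (a i) = some (a' i)) ∧
          (∀ i, E.proj w (b i) = some (b' i)) ∧
          tp (Fin.append a' b') = p ∧
          e w hw = Quotient.mk R p

end Extension

/-- `s` is an existential limit of `t`, as witnessed by `v_*`. -/
def IsExistentialLimit (s t : Powis.{u}) (vs : s.J) : Prop :=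
  ∃ E : Extension s t vs, E.IsLimit ∧ E.IsExistential

/-! ### Almost `κ`-automorphism groups -/

/-- The automorphism group of a structure, as a group of permutations of its universe. -/
def autGroup (𝓛 : FirstOrder.Language.{u, u}) (M : Type u) [𝓛.Structure M] :
    Subgroup (Equiv.Perm M) where
  carrier := {σ | ∃ φ : FirstOrder.Language.Equiv 𝓛 M M, φ.toEquiv = σ}
  mul_mem' := by
    rintro _ _ ⟨φ, rfl⟩ ⟨ψ, rfl⟩
    exact ⟨φ.comp ψ, rfl⟩
  one_mem' := ⟨FirstOrder.Language.Equiv.refl 𝓛 M, rfl⟩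
  inv_mem' := by
    rintro _ ⟨φ, rfl⟩
    exact ⟨φ.symm, rfl⟩

/-- `G` is a `κ`-automorphism group: it is the automorphism group of a structure of cardinality at
most `κ`. -/
def IsKappaAutGroup (κ : Cardinal.{u}) (G : Type u) [Group G] : Prop :=
  ∃ (𝓛 : FirstOrder.Language.{u, u}) (M : Type u) (_ : 𝓛.Structure M),
    Cardinal.mk M ≤ κ ∧ Nonempty (G ≃* autGroup 𝓛 M)

/-- `G` is an almost `κ`-automorphism group: it is isomorphic to the quotient of a
`κ`-automorphism group by a normal subgroup of cardinality at most `κ`. -/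
def IsAlmostKappaAutGroup (κ : Cardinal.{u}) (G : Type u) [Group G] : Prop :=
  ∃ (Gp : Type u) (_ : Group Gp), IsKappaAutGroup κ Gp ∧
    ∃ (Gm : Subgroup Gp) (_ : Gm.Normal),
      Cardinal.mk Gm ≤ κ ∧ Nonempty (G ≃* Gp ⧸ Gm)

end AutTower

/-! An element of `K I` is the value of a word with finitely many parameters from `I`. A partial map
that is injective and reflects `<` where it is defined induces a homomorphism, the generators that
it does not carry to generators going to `1` (`exists_kHom`). Two consequences: every element has a
least support (`exists_support`), and whether two words have equal values depends only on the
quantifier-free type of the parameters (`ev_eq_of_tp_eq`).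

The maps `π` need neither preserve nor reflect the order, so they need not act on the groups, but
they act on words. Call a sequence in the product of the `K (t.I v)` locally coherent if below each
`v` it is the sequence of values of a single word over `t.I v`, its parameters being moved by `π`.
These sequences form a closed permutation group on a set of size at most `κ`, hence a
`κ`-automorphism group. A word over `s.I vs` projects to such a sequence, and its value is `1` iff
the sequence is eventually `1`, because finite tuples eventually have the type of their projections.
As `t.J` is linear, at most `κ` locally coherent sequences are eventually `1`.

It remains to see that each locally coherent `k` is eventually the projection of a word over `s.I
vs` (`exists_eventually_eq`). By `ℵ₁`-directedness one shape `σ` serves for all large `v`, with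
parameters depending on `v`. The least supports lie inside these parameters; an ultrafilter makes
them cohere on a cofinal set, so they have a limit in `s.I vs`, and one word `τ` in that limit
computes `k` cofinally often. The existential clause, applied to the question whether `τ` and `σ`
agree, turns "cofinally often" into "eventually". -/

namespace AutTower

/-! ### Words in the generators of `K_I` and their functoriality -/

section Words

/-- Names of the generators of `K_I` with parameters in `V`: `none` stands for `h_{G^{<0}}`, and
`some (t̄, η)` for `g_{(t̄, η)}`. -/
abbrev Letter (V : Type*) := Option (List V × List (Fin 2))

/-- Words in the generators with parameters in `V`. -/
abbrev Wrd (V : Type*) := FreeGroup (Letter V)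

/-- Substitution of parameters in a word. -/
def subst {V W : Type*} (f : V → W) : Wrd V →* Wrd W :=
  FreeGroup.map (Option.map (Prod.map (List.map f) id))

theorem subst_of_none {V W : Type*} (f : V → W) :
    subst f (FreeGroup.of none) = FreeGroup.of none := rfl

theorem subst_of_some {V W : Type*} (f : V → W) (t : List V) (η : List (Fin 2)) :
    subst f (FreeGroup.of (some (t, η))) = FreeGroup.of (some (t.map f, η)) := rfl

theorem subst_subst {V W Z : Type*} (f : V → W) (f' : W → Z) (w : Wrd V) :
    subst f' (subst f w) = subst (f' ∘ f) w := by
  unfold subst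
  rw [FreeGroup.map.comp]
  congr 2
  funext x
  rcases x with _ | ⟨t, η⟩ <;> simp

variable {I I' : Type u} [PartialOrder I] [PartialOrder I']

open Classical in
/-- `g_{(t̄, η)}` if `t̄` consists of elements of `I` and `(t̄, η) ∈ X_I`, and `1` otherwise. -/
noncomputable def gLift (t : List (Option I)) (η : List (Fin 2)) : G I :=
  if hx : ∃ x : X I, x.t.map some = t ∧ x.η = η then g hx.choose else 1

theorem gLift_of (x : X I) : gLift (x.t.map some) x.η = g x := by
  have hx : ∃ y : X I, y.t.map some = x.t.map some ∧ y.η = x.η := ⟨x, rfl, rfl⟩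
  rw [gLift, dif_pos hx]
  congr 1
  exact X.ext (List.map_injective_iff.2 (Option.some_injective I) hx.choose_spec.1)
    hx.choose_spec.2

theorem gLift_eq {t : List (Option I)} {η : List (Fin 2)} (x : X I) (ht : x.t.map some = t)
    (hη : x.η = η) : gLift t η = g x := by
  subst ht hη
  exact gLift_of x

theorem gLift_eq_one {t : List (Option I)} {η : List (Fin 2)}
    (hx : ¬ ∃ x : X I, x.t.map some = t ∧ x.η = η) : gLift t η = 1 := by
  rw [gLift, dif_neg hx]

theorem g_invol (x : X I) : (g x)⁻¹ * (g x)⁻¹ = 1 :=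
  PresentedGroup.one_of_mem (GRel.invol x)

theorem g_comm (y₁ y₂ : X I) (hn : y₁.n = y₂.n) : g y₁ * g y₂ * (g y₂ * g y₁)⁻¹ = 1 :=
  PresentedGroup.one_of_mem (GRel.comm y₁ y₂ hn)

theorem g_conj (x y₁ y₂ : X I) (hc : Circ x y₁ y₂) : g x * g y₁ * (g x)⁻¹ * (g y₂)⁻¹ = 1 :=
  PresentedGroup.one_of_mem (GRel.conj x y₁ y₂ hc)

/-- The value in `K_I` of a word whose parameters are in `I` or undefined. -/
noncomputable def ev (I : Type u) [PartialOrder I] : Wrd (Option I) →* K I :=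
  FreeGroup.lift fun l => match l with
    | none => SemidirectProduct.inl (h ((1 : G I) : Coset I))
    | some (t, η) => SemidirectProduct.inr (gLift t η)

theorem ev_none : ev I (FreeGroup.of none) = SemidirectProduct.inl (h ((1 : G I) : Coset I)) := by
  rw [ev, FreeGroup.lift_apply_of]

theorem ev_some (t : List (Option I)) (η : List (Fin 2)) :
    ev I (FreeGroup.of (some (t, η))) = SemidirectProduct.inr (gLift t η) := by
  rw [ev, FreeGroup.lift_apply_of]

/-- One letter for `L I` suffices: the action of `G I` on cosets is transitive, so all `h_a` are
conjugate in `K I` to the one at the trivial coset. -/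
theorem ev_surjective : Function.Surjective (ev I) := by
  have hr : ∀ a : G I, SemidirectProduct.inr a ∈ (ev I).range := by
    intro a
    refine PresentedGroup.generated_by _ ((ev I).range.comap SemidirectProduct.inr) ?_ a
    intro x
    refine ⟨FreeGroup.of (some (x.t.map some, x.η)), ?_⟩
    rw [ev_some, gLift_of]
    rfl
  have hl : ∀ a : L I, SemidirectProduct.inl a ∈ (ev I).range := by
    intro a
    refine PresentedGroup.generated_by _ ((ev I).range.comap SemidirectProduct.inl) ?_ a
    intro c
    induction c using QuotientGroup.induction_on with | _ f => ?_
    change SemidirectProduct.inl (h (f : Coset I)) ∈ (ev I).range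
    have e : h (f : Coset I) = act I f (h ((1 : G I) : Coset I)) := by
      rw [act_h]
      change _ = h ((f * 1 : G I) : Coset I)
      rw [mul_one]
    rw [e, SemidirectProduct.inl_aut]
    refine mul_mem (mul_mem (hr _) ⟨FreeGroup.of none, ev_none⟩) (hr _)
  intro k
  rw [← SemidirectProduct.inl_left_mul_inr_right k]
  exact mul_mem (hl _) (hr _)

/-- A partial map, injective where it is defined and reflecting the strict order. -/
structure Reflects (f : Option I → Option I') : Prop where
  none : f none = none
  inj : ∀ a b c, f (some a) = some c → f (some b) = some c → a = b
  lt : ∀ a b a' b', f (some a) = some a' → f (some b) = some b' → a' < b' → a < b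

theorem Reflects.list_inj {f : Option I → Option I'} (hf : Reflects f) {l₁ l₂ : List I}
    {l' : List I'} (h₁ : l₁.map (fun a => f (some a)) = l'.map some)
    (h₂ : l₂.map (fun a => f (some a)) = l'.map some) : l₁ = l₂ := by
  induction l' generalizing l₁ l₂ with
  | nil => simp_all
  | cons c l' ih =>
    cases l₁ <;> cases l₂ <;> simp_all
    exact ⟨hf.inj _ _ _ h₁.1 h₂.1, ih h₁.2 h₂.2⟩

/-- Reflecting `<` is needed here: a pair that names no generator, and so has value `1`, must not be
carried to one that does. -/
theorem Reflects.exists_lift {f : Option I → Option I'} (hf : Reflects f)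
    {t : List (Option I)} {η : List (Fin 2)} (x' : X I') (ht : x'.t.map some = t.map f)
    (hη : x'.η = η) : ∃ x : X I, x.t.map some = t ∧ x.η = η := by
  have hl : ∃ l : List I, l.map some = t := by
    refine ⟨t.reduceOption, ?_⟩
    have : ∀ a ∈ t, a.isSome := by
      intro a ha
      have : f a ∈ x'.t.map some := ht ▸ List.mem_map_of_mem ha
      obtain ⟨b, -, hb⟩ := List.mem_map.1 this
      cases a with
      | none => simp [hf.none] at hb
      | some a => rfl
    clear ht
    induction t with
    | nil => rfl
    | cons a t ih =>
      obtain ⟨b, rfl⟩ := Option.isSome_iff_exists.1 (this a (by simp))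
      rw [List.reduceOption_cons_of_some, List.map_cons, ih]
      intro a ha
      exact this a (by simp [ha])
  obtain ⟨l, rfl⟩ := hl
  refine ⟨⟨l, η, ?_, ?_⟩, rfl, rfl⟩
  · have := congrArg List.length ht
    simp only [List.length_map] at this
    rw [← this, x'.length_eq, hη]
  · have hd := x'.decreasing
    have key : ∀ (l : List I) (l' : List I'), l'.map some = (l.map some).map f →
        l'.Pairwise (fun a b => b < a) → l.Pairwise (fun a b => b < a) := by
      intro l
      induction l with
      | nil => simp
      | cons a l ih =>
        intro l' hl' hd
        cases l' with
        | nil => simp at hl'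
        | cons a' l' =>
          simp only [List.map_cons, List.cons.injEq] at hl'
          rw [List.pairwise_cons] at hd ⊢
          refine ⟨fun b hb => ?_, ih l' hl'.2 hd.2⟩
          have hb' : f (some b) ∈ l'.map some := by
            rw [hl'.2]
            exact List.mem_map_of_mem (List.mem_map_of_mem hb)
          obtain ⟨b', hb'1, hb'2⟩ := List.mem_map.1 hb'
          exact hf.lt _ _ _ _ hb'2.symm hl'.1.symm (hd.1 b' hb'1)
    exact key l _ ht hd

/-- The relation tests whether `x` is an initial segment of `y₁`; injectivity of `f` ensures that
the images do not become equal when the originals differ. -/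
theorem circ_of_circ {f : Option I → Option I'} (hf : Reflects f) {x y₁ y₂ : X I}
    {x' y₁' y₂' : X I'} (hc : Circ x y₁ y₂)
    (hx : x'.t.map some = x.t.map (fun a => f (some a))) (hxη : x'.η = x.η)
    (h₁ : y₁'.t.map some = y₁.t.map (fun a => f (some a))) (h₁η : y₁'.η = y₁.η)
    (h₂ : y₂'.t = y₁'.t) (h₂η : y₂'.η = y₂.η) : Circ x' y₁' y₂' := by
  obtain ⟨c₁, c₂, c₃, c₄, c₅⟩ := hc
  have ex : x'.n = x.n := congrArg List.length hxη
  have e₁ : y₁'.n = y₁.n := congrArg List.length h₁η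
  have e₂ : y₂'.n = y₂.n := congrArg List.length h₂η
  refine ⟨by omega, by omega, ?_, h₂.symm, ?_⟩
  · apply X.ext
    · simp [X.restr, h₂]
    · have := congrArg X.η c₃
      simpa [X.restr, h₁η, h₂η, ex] using this
  · intro l hl
    rw [h₁η, h₂η, c₅ l (by omega)]
    refine and_congr (by rw [ex]) ?_
    have tk : (y₁'.t.take (x.n + 1)).map some
        = (y₁.t.take (x.n + 1)).map (fun a => f (some a)) := by
      rw [List.map_take, h₁, List.map_take]
    constructor
    · intro e
      apply X.ext
      · apply List.map_injective_iff.2 (Option.some_injective I')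
        have := congrArg X.t e
        simp only [X.restr] at this ⊢
        rw [hx, ex, tk, this]
      · have := congrArg X.η e
        simp only [X.restr] at this ⊢
        rw [hxη, ex, h₁η, this]
    · intro e
      apply X.ext
      · have := congrArg X.t e
        simp only [X.restr, ex] at this ⊢
        exact hf.list_inj hx.symm (by rw [this, tk])
      · have := congrArg X.η e
        simp only [X.restr, ex] at this ⊢
        rw [← hxη, this, h₁η]

/-- The homomorphism `G_I → G_{I'}` induced by a partial map. -/
theorem exists_gHom {f : Option I → Option I'} (hf : Reflects f) :
    ∃ φ : G I →* G I', ∀ t η, φ (gLift t η) = gLift (t.map f) η := by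
  let v : X I → G I' := fun x => gLift (x.t.map fun a => f (some a)) x.η
  have hv : ∀ r ∈ {r : FreeGroup (X I) | GRel r}, FreeGroup.lift v r = 1 := by
    rintro r (⟨x⟩ | ⟨y₁, y₂, hn⟩ | ⟨x, y₁, y₂, hc⟩)
    · simp only [map_mul, map_inv, FreeGroup.lift_apply_of]
      by_cases hx : ∃ x' : X I', x'.t.map some = x.t.map (fun a => f (some a)) ∧ x'.η = x.η
      · obtain ⟨x', h₁, h₂⟩ := hx
        simp only [v, gLift_eq x' h₁ h₂, g_invol]
      · simp only [v, gLift_eq_one hx, inv_one, mul_one]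
    · simp only [map_mul, map_inv, FreeGroup.lift_apply_of]
      by_cases h₁ : ∃ x' : X I', x'.t.map some = y₁.t.map (fun a => f (some a)) ∧ x'.η = y₁.η
      · by_cases h₂ : ∃ x' : X I', x'.t.map some = y₂.t.map (fun a => f (some a)) ∧ x'.η = y₂.η
        · obtain ⟨x₁, a₁, b₁⟩ := h₁
          obtain ⟨x₂, a₂, b₂⟩ := h₂
          simp only [v, gLift_eq x₁ a₁ b₁, gLift_eq x₂ a₂ b₂]
          exact g_comm _ _ (by simpa [X.n, b₁, b₂] using hn)
        · simp [v, gLift_eq_one h₂]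
      · simp [v, gLift_eq_one h₁]
    · simp only [map_mul, map_inv, FreeGroup.lift_apply_of]
      have hc' := hc
      obtain ⟨c₁, c₂, c₃, c₄, c₅⟩ := hc'
      by_cases h₁ : ∃ x' : X I', x'.t.map some = y₁.t.map (fun a => f (some a)) ∧ x'.η = y₁.η
      · obtain ⟨y₁', a₁, b₁⟩ := h₁
        -- `y₁` and `y₂` have the same decreasing sequence, so they survive under `f` together or
        -- not at all.
        let y₂' : X I' := ⟨y₁'.t, y₂.η, by
          rw [y₁'.length_eq, b₁]
          exact congrArg (· + 1) c₂, y₁'.decreasing⟩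
        by_cases hx : ∃ x' : X I', x'.t.map some = x.t.map (fun a => f (some a)) ∧ x'.η = x.η
        · obtain ⟨x', a, b⟩ := hx
          have e₂ : gLift (y₂.t.map fun a => f (some a)) y₂.η = g y₂' :=
            gLift_eq y₂' (a₁.trans (by rw [c₄])) rfl
          simp only [v, gLift_eq x' a b, gLift_eq y₁' a₁ b₁, e₂]
          exact g_conj _ _ _ (circ_of_circ hf hc a b a₁ b₁ rfl rfl)
        -- An initial segment of a surviving `y₁` survives. So if `x` is killed, it is not such a
        -- segment; then `y₁ = y₂` and the relator becomes trivial.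
        · have hne : x ≠ y₁.restr x.n c₁.le := by
            intro e
            have hle : x.n ≤ y₁'.n := by
              change _ ≤ y₁'.η.length
              rw [b₁]
              exact c₁.le
            refine hx ⟨y₁'.restr x.n hle, ?_, ?_⟩
            · have := congrArg X.t e
              simp only [X.restr] at this ⊢
              rw [this, List.map_take, a₁, List.map_take]
            · have := congrArg X.η e
              simp only [X.restr] at this ⊢
              rw [this, b₁]
          have hη : y₁.η = y₂.η := by
            apply List.ext_getElem?
            intro l
            by_cases hl : l < y₁.n
            · by_contra hne'
              exact hne ((c₅ l hl).1 hne').2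
            · have h2 : y₂.η.length ≤ l := by
                change y₂.n ≤ l
                omega
              have h1 : y₁.η.length ≤ l := by
                change y₁.n ≤ l
                omega
              rw [List.getElem?_eq_none h1, List.getElem?_eq_none h2]
          have : y₁ = y₂ := X.ext c₄ hη
          simp only [v, gLift_eq_one hx, this]
          simp
      · have h₂ : ¬ ∃ x' : X I', x'.t.map some = y₂.t.map (fun a => f (some a)) ∧ x'.η = y₂.η := by
          rintro ⟨y₂', a₂, b₂⟩
          refine h₁ ⟨⟨y₂'.t, y₁.η, ?_, y₂'.decreasing⟩, a₂.trans (by rw [c₄]), rfl⟩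
          rw [y₂'.length_eq, b₂]
          exact congrArg (· + 1) c₂.symm
        simp [v, gLift_eq_one h₁, gLift_eq_one h₂]
  refine ⟨PresentedGroup.toGroup hv, fun t η => ?_⟩
  by_cases hx : ∃ x : X I, x.t.map some = t ∧ x.η = η
  · obtain ⟨x, rfl, rfl⟩ := hx
    rw [gLift_of, List.map_map]
    exact PresentedGroup.toGroup.of hv
  · rw [gLift_eq_one hx, map_one, gLift_eq_one]
    rintro ⟨x', h₁, h₂⟩
    exact hx (hf.exists_lift x' h₁ h₂)

/-- The homomorphism `K_I → K_{I'}` induced by a partial map. -/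
theorem exists_kHom {f : Option I → Option I'} (hf : Reflects f) :
    ∃ φ : K I →* K I', ∀ w, φ (ev I w) = ev I' (subst f w) := by
  obtain ⟨φ, hφ⟩ := exists_gHom hf
  have hle : GltZero I ≤ (GltZero I').comap φ := by
    rw [GltZero, Subgroup.closure_le]
    rintro _ ⟨x, hx, rfl⟩
    change φ (g x) ∈ GltZero I'
    rw [← gLift_of, hφ]
    by_cases h' : ∃ x' : X I', x'.t.map some = (x.t.map some).map f ∧ x'.η = x.η
    · obtain ⟨x', h₁, h₂⟩ := h'
      rw [gLift_eq x' h₁ h₂]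
      exact Subgroup.subset_closure ⟨x', h₂ ▸ hx, rfl⟩
    · rw [gLift_eq_one h']
      exact one_mem _
  let q : Coset I → Coset I' := Quotient.map' φ (by
    intro a b hab
    rw [QuotientGroup.leftRel_apply] at hab ⊢
    simpa using hle hab)
  have hq : ∀ a : G I, q (a : Coset I) = ((φ a : G I') : Coset I') := fun a => rfl
  have hqs : ∀ (a : G I) (c : Coset I), q (a • c) = φ a • q c := by
    intro a c
    induction c using QuotientGroup.induction_on with | _ b => ?_
    change q ((a * b : G I) : Coset I) = ((φ a * φ b : G I') : Coset I')
    rw [hq, map_mul]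
  let ψ : L I →* L I' := PresentedGroup.toGroup (f := fun a => h (q a)) (by
    rintro r (⟨a, b⟩ | ⟨a⟩)
    · simpa using h_comm I' (q a) (q b)
    · simpa using h_invol I' (q a))
  have hψ : ∀ a, ψ (h a) = h (q a) := fun a => PresentedGroup.toGroup.of _
  refine ⟨SemidirectProduct.map ψ φ ?_, ?_⟩
  · intro a
    refine PresentedGroup.ext fun c => ?_
    change ψ (act I a (h c)) = act I' (φ a) (ψ (h c))
    rw [act_h, hψ, hψ, act_h, hqs]
  · intro w
    rw [← MonoidHom.comp_apply, ← MonoidHom.comp_apply]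
    congr 1
    refine FreeGroup.ext_hom _ _ fun l => ?_
    rcases l with _ | ⟨t, η⟩
    · rw [MonoidHom.comp_apply, MonoidHom.comp_apply, ev_none, subst_of_none, ev_none,
        SemidirectProduct.map_inl, hψ, hq, map_one]
    · rw [MonoidHom.comp_apply, MonoidHom.comp_apply, ev_some, subst_of_some, ev_some,
        SemidirectProduct.map_inr, hφ]

theorem ev_subst_eq_of_eq {f : Option I → Option I'} (hf : Reflects f) {w w' : Wrd (Option I)}
    (e : ev I w = ev I w') : ev I' (subst f w) = ev I' (subst f w') := by
  obtain ⟨φ, hφ⟩ := exists_kHom hf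
  rw [← hφ, ← hφ, e]

end Words

end AutTower

namespace AutTower

/-! ### Supports, and dependence on quantifier free types only -/

section Supports

/-- The extension of a partial map by `none ↦ none`. -/
def strict {V W : Type*} (s : V → Option W) : Option V → Option W := fun o => o.bind s

@[simp] theorem strict_none {V W : Type*} (s : V → Option W) : strict s none = none := rfl

@[simp] theorem strict_some {V W : Type*} (s : V → Option W) (a : V) :
    strict s (some a) = s a := rfl

theorem comp_strict {V W Z : Type*} (s : V → Option W) {f : Option W → Option Z}
    (hf : f none = none) : f ∘ strict s = strict (f ∘ s) := by
  funext o
  cases o <;> simp [hf]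

theorem exists_shape {A : Type*} (w : Wrd A) :
    ∃ (n : ℕ) (s : Fin n → A) (σ : Wrd (Fin n)), subst s σ = w := by
  induction w using FreeGroup.induction_on with
  | C1 => exact ⟨0, Fin.elim0, 1, map_one _⟩
  | of x =>
    rcases x with _ | ⟨t, η⟩
    · exact ⟨0, Fin.elim0, FreeGroup.of none, rfl⟩
    · refine ⟨t.length, t.get, FreeGroup.of (some (List.finRange t.length, η)), ?_⟩
      rw [subst_of_some]
      congr 3
      simp
  | inv_of x hx =>
    obtain ⟨n, s, σ, e⟩ := hx
    exact ⟨n, s, σ⁻¹, by rw [map_inv, e]⟩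
  | mul x y hx hy =>
    obtain ⟨n, s, σ, e⟩ := hx
    obtain ⟨n', s', σ', e'⟩ := hy
    refine ⟨n + n', Fin.append s s', subst (Fin.castAdd n') σ * subst (Fin.natAdd n) σ', ?_⟩
    rw [map_mul, subst_subst, subst_subst, ← e, ← e']
    congr 3
    · funext i
      simp
    · funext i
      simp

theorem exists_strict_shape {A : Type*} (w : Wrd (Option A)) :
    ∃ (n : ℕ) (s : Fin n → Option A) (σ : Wrd (Option (Fin n))), subst (strict s) σ = w := by
  obtain ⟨n, s, σ, e⟩ := exists_shape w
  refine ⟨n, s, subst some σ, ?_⟩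
  rw [subst_subst, ← e]
  rfl

/-- An undefined parameter can be absorbed into the shape, as `finSuccEquiv' i` sends `i` to `none`.
This drives the arguments by a minimal number of parameters. -/
theorem subst_strict_drop {A : Type*} {n : ℕ} (s : Fin (n + 1) → Option A) (i : Fin (n + 1))
    (hi : s i = none) (σ : Wrd (Option (Fin (n + 1)))) :
    subst (strict (s ∘ i.succAbove)) (subst (strict (finSuccEquiv' i)) σ)
      = subst (strict s) σ := by
  rw [subst_subst]
  congr 2
  funext o
  rcases o with _ | j
  · rfl
  · simp only [Function.comp_apply, strict_some]
    rcases eq_or_ne j i with rfl | hj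
    · simp [hi]
    · obtain ⟨l, rfl⟩ := Fin.exists_succAbove_eq hj
      simp

theorem exists_total_shape {A : Type*} (w : Wrd (Option A)) :
    ∃ (n : ℕ) (s : Fin n → A) (σ : Wrd (Option (Fin n))),
      subst (strict fun i => some (s i)) σ = w := by
  obtain ⟨n, s, σ, e⟩ := exists_strict_shape w
  induction n with
  | zero => exact ⟨0, Fin.elim0, σ, by rw [← e]; congr 3; funext i; exact i.elim0⟩
  | succ n ih =>
    by_cases hs : ∃ i, s i = none
    · obtain ⟨i, hi⟩ := hs
      exact ih _ _ ((subst_strict_drop s i hi σ).trans e)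
    · push Not at hs
      choose c hc using fun i => Option.ne_none_iff_exists'.1 (hs i)
      exact ⟨n + 1, c, σ, by rw [← e]; congr 3; funext i; exact (hc i).symm⟩

variable {I I' : Type u} [PartialOrder I] [PartialOrder I']

/-- Every element of `K_I` is the value of a word whose tuple of parameters is contained in every
other tuple representing that element. -/
theorem exists_support (k : K I) : ∃ (m : ℕ) (c : Fin m → I) (τ : Wrd (Option (Fin m))),
    ev I (subst (strict fun j => some (c j)) τ) = k ∧
    ∀ (n : ℕ) (s : Fin n → Option I) (σ : Wrd (Option (Fin n))),
      ev I (subst (strict s) σ) = k → ∀ j, ∃ i, s i = some (c j) := by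
  classical
  have hex : ∃ (m : ℕ) (c : Fin m → Option I) (τ : Wrd (Option (Fin m))),
      ev I (subst (strict c) τ) = k := by
    obtain ⟨w, rfl⟩ := ev_surjective k
    obtain ⟨n, s, σ, rfl⟩ := exists_strict_shape w
    exact ⟨n, s, σ, rfl⟩
  -- The support is a representing tuple of minimal length; by minimality no representation with
  -- shape `τ` has an undefined entry.
  have hmin := fun m (hm : m < Nat.find hex) => Nat.find_min hex hm
  obtain ⟨c, τ, hc⟩ := Nat.find_spec hex
  revert hmin c τ hc
  generalize Nat.find hex = m
  intro hmin c τ hc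
  have hne : ∀ (c : Fin m → Option I), ev I (subst (strict c) τ) = k → ∀ j, c j ≠ none := by
    intro c hc j hj
    cases m with
    | zero => exact j.elim0
    | succ m =>
      exact hmin m (Nat.lt_succ_self m) ⟨_, _, (congrArg _ (subst_strict_drop c j hj τ)).trans hc⟩
  choose c' hc' using fun j => Option.ne_none_iff_exists'.1 (hne c hc j)
  refine ⟨m, c', τ, ?_, ?_⟩
  · rw [← hc]
    congr 4
    funext j
    exact (hc' j).symm
  · intro n s σ hs j
    by_contra hj
    push Not at hj
    -- Deleting `c' j` leaves the word in `s`, hence `k`, unchanged, yet makes entry `j` of the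
    -- other representation undefined, against minimality.
    let f : Option I → Option I := fun o => if o = some (c' j) then none else o
    have hf : Reflects f := by
      refine ⟨by simp [f], ?_, ?_⟩
      · intro a b d
        simp only [f]
        split_ifs <;> simp_all
      · intro a b a' b'
        simp only [f]
        split_ifs <;> simp_all
    have e := ev_subst_eq_of_eq hf (hs.trans hc.symm)
    rw [subst_subst, subst_subst, comp_strict _ hf.none, comp_strict _ hf.none] at e
    have hfs : f ∘ s = s := by
      funext i
      simp [f, hj i]
    rw [hfs, hs] at e
    exact hne _ e.symm j (by simp [f, hc'])

/-- Equality of the values of two words depends only on the order relations between the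
parameters. -/
theorem ev_eq_of_same_type {V : Type*} {s : V → I} {s' : V → I'}
    (hlt : ∀ i j, s i < s j ↔ s' i < s' j) (heq : ∀ i j, s i = s j ↔ s' i = s' j)
    {w w' : Wrd (Option V)}
    (e : ev I (subst (strict fun i => some (s i)) w)
      = ev I (subst (strict fun i => some (s i)) w')) :
    ev I' (subst (strict fun i => some (s' i)) w)
      = ev I' (subst (strict fun i => some (s' i)) w') := by
  classical
  -- The partial map `s i ↦ s' i`, undefined off the range of `s`.
  let f : Option I → Option I' :=
    strict fun a => if ha : ∃ i, s i = a then some (s' ha.choose) else none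
  have hfs : ∀ i, f (some (s i)) = some (s' i) := by
    intro i
    have ha : ∃ j, s j = s i := ⟨i, rfl⟩
    simp only [f, strict_some]
    rw [dif_pos ha, (heq _ _).1 ha.choose_spec]
  have hran : ∀ a a', f (some a) = some a' → ∃ i, s i = a ∧ s' i = a' := by
    intro a a' haa
    by_cases ha : ∃ i, s i = a
    · obtain ⟨i, rfl⟩ := ha
      rw [hfs] at haa
      exact ⟨i, rfl, Option.some_injective _ haa⟩
    · simp [f, ha] at haa
  have hf : Reflects f := by
    refine ⟨rfl, ?_, ?_⟩
    · intro a b c ha hb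
      obtain ⟨i, rfl, rfl⟩ := hran a c ha
      obtain ⟨j, rfl, hj⟩ := hran b _ hb
      exact (heq _ _).2 hj.symm
    · intro a b a' b' ha hb hab
      obtain ⟨i, rfl, rfl⟩ := hran a a' ha
      obtain ⟨j, rfl, rfl⟩ := hran b b' hb
      exact (hlt _ _).2 hab
  have e' := ev_subst_eq_of_eq hf e
  rw [subst_subst, subst_subst, comp_strict _ hf.none] at e'
  have : (f ∘ fun i => some (s i)) = fun i => some (s' i) := funext hfs
  rwa [this] at e'

theorem lt_iff_of_tp_eq {n : ℕ} {s : Fin n → I} {s' : Fin n → I'}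
    (e : (tp s : QfType.{u} n) = tp s') (i j : Fin n) : s i < s j ↔ s' i < s' j := by
  have e' : tpqf s = tpqf s' := congrArg Subtype.val e
  have := Set.ext_iff.1 e' (0, i, j)
  simp only [tpqf, Set.mem_ofPred_eq] at this
  split_ifs at this <;> simp_all

theorem eq_iff_of_tp_eq {n : ℕ} {s : Fin n → I} {s' : Fin n → I'}
    (e : (tp s : QfType.{u} n) = tp s') (i j : Fin n) : s i = s j ↔ s' i = s' j := by
  have e' : tpqf s = tpqf s' := congrArg Subtype.val e
  have := Set.ext_iff.1 e' (1, i, j)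
  have hl := lt_iff_of_tp_eq e i j
  simp only [tpqf, Set.mem_ofPred_eq] at this
  split_ifs at this <;> simp_all [LT.lt.ne]

theorem ev_eq_of_tp_eq {n : ℕ} {s : Fin n → I} {s' : Fin n → I'}
    (e : (tp s : QfType.{u} n) = tp s') (w w' : Wrd (Option (Fin n))) :
    ev I (subst (strict fun i => some (s i)) w) = ev I (subst (strict fun i => some (s i)) w') ↔
    ev I' (subst (strict fun i => some (s' i)) w)
      = ev I' (subst (strict fun i => some (s' i)) w') :=
  ⟨ev_eq_of_same_type (lt_iff_of_tp_eq e) (eq_iff_of_tp_eq e),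
    ev_eq_of_same_type (fun i j => (lt_iff_of_tp_eq e i j).symm)
      fun i j => (eq_iff_of_tp_eq e i j).symm⟩

end Supports

end AutTower

namespace AutTower

/-! ### Closed groups of permutations -/

section Closed

/-- The language with one `n`-ary relation symbol for every `n`-tuple of `M`. -/
def orbitLanguage (M : Type u) : FirstOrder.Language.{u, u} where
  Functions _ := PEmpty
  Relations n := Fin n → M

/-- The symbol of the tuple `b` is interpreted by the orbit of `b`. -/
@[reducible]
def orbitStructure (Γ M : Type u) [Group Γ] [MulAction Γ M] : (orbitLanguage M).Structure M where
  funMap f := f.elim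
  RelMap b a := ∃ γ : Γ, ∀ i, a i = γ • b i

/-- A faithful action whose image is closed in the topology of pointwise convergence is the action
of an automorphism group. -/
theorem isKappaAutGroup_of_closed {κ : Cardinal.{u}} {Γ M : Type u} [Group Γ] [MulAction Γ M]
    [FaithfulSMul Γ M] (hM : Cardinal.mk M ≤ κ)
    (hcl : ∀ σ : Equiv.Perm M, (∀ (n : ℕ) (a : Fin n → M), ∃ γ : Γ, ∀ i, σ (a i) = γ • a i) →
      ∃ γ : Γ, ∀ x, σ x = γ • x) : IsKappaAutGroup κ Γ := by
  let 𝓛 := orbitLanguage M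
  let _ : 𝓛.Structure M := orbitStructure Γ M
  refine ⟨𝓛, M, inferInstance, hM, ⟨?_⟩⟩
  have hmem : ∀ γ : Γ, MulAction.toPermHom Γ M γ ∈ autGroup 𝓛 M := by
    intro γ
    refine ⟨⟨MulAction.toPerm γ, fun f => PEmpty.elim f, ?_⟩, rfl⟩
    intro n b a
    constructor
    · rintro ⟨δ, hδ⟩
      refine ⟨γ⁻¹ * δ, fun i => ?_⟩
      rw [mul_smul, ← hδ i]
      exact (inv_smul_smul γ (a i)).symm
    · rintro ⟨δ, hδ⟩
      refine ⟨γ * δ, fun i => ?_⟩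
      rw [mul_smul, ← hδ i]
      rfl
  refine MulEquiv.ofBijective ((MulAction.toPermHom Γ M).codRestrict (autGroup 𝓛 M) hmem) ⟨?_, ?_⟩
  · intro γ δ e
    exact MulAction.toPerm_injective (congrArg Subtype.val e)
  · rintro ⟨_, φ, rfl⟩
    obtain ⟨γ, hγ⟩ := hcl φ.toEquiv (by
      intro n a
      -- The tuple `a` satisfies the relation named by itself, so its image lies in the orbit of
      -- `a`.
      exact (φ.map_rel' (a : 𝓛.Relations n) a).2 ⟨1, fun i => (one_smul Γ (a i)).symm⟩)
    refine ⟨γ, Subtype.ext (Equiv.ext fun x => ?_)⟩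
    exact (hγ x).symm

end Closed

/-! ### Locally coherent sequences -/

namespace Powis

variable (t : Powis.{u})

/-- The map `π_{v,w}` between the sets `I_w ∪ {undefined}` and `I_v ∪ {undefined}`. -/
def piHat {v w : t.J} (hvw : v ≤ w) : Option (t.I w) → Option (t.I v) := strict (t.π hvw)

theorem piHat_comp {v w z : t.J} (hvw : v ≤ w) (hwz : w ≤ z) :
    t.piHat hvw ∘ t.piHat hwz = t.piHat (hvw.trans hwz) := by
  funext o
  rcases o with _ | x
  · rfl
  · exact (t.π_comp hvw hwz x).symm

theorem piHat_piHat {v w z : t.J} (hvw : v ≤ w) (hwz : w ≤ z) (o : Option (t.I z)) :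
    t.piHat hvw (t.piHat hwz o) = t.piHat (hvw.trans hwz) o :=
  congrFun (t.piHat_comp hvw hwz) o

/-- A word with parameters in `I_v` evaluated in all `K_{I_w}`, `w ≤ v`. -/
noncomputable def wordHom (v : t.J) :
    Wrd (Option (t.I v)) →* ∀ w : {w : t.J // w ≤ v}, K (t.I w.1) :=
  MonoidHom.mk' (fun x w => ev (t.I w.1) (subst (t.piHat w.2) x)) fun x y => by
    funext w
    simp only [map_mul, Pi.mul_apply]

/-- Restriction to the coordinates below `v`. -/
def restr (v : t.J) : (∀ w : t.J, K (t.I w)) →* ∀ w : {w : t.J // w ≤ v}, K (t.I w.1) :=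
  MonoidHom.mk' (fun k w => k w.1) fun _ _ => rfl

/-- The group of those sequences in `∏_v K_{I_v}` which below every `v` are the values of a word
with parameters in `I_v`. -/
noncomputable def locallyCoherent : Subgroup (∀ w : t.J, K (t.I w)) :=
  ⨅ v, (t.wordHom v).range.comap (t.restr v)

variable {t}

theorem mem_locallyCoherent {k : ∀ w : t.J, K (t.I w)} :
    k ∈ t.locallyCoherent ↔ ∀ v, ∃ x : Wrd (Option (t.I v)), ∀ (w : t.J) (hw : w ≤ v),
      k w = ev (t.I w) (subst (t.piHat hw) x) := by
  rw [locallyCoherent, Subgroup.mem_iInf]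
  refine forall_congr' fun v => ?_
  constructor
  · rintro ⟨x, hx⟩
    exact ⟨x, fun w hw => (congrFun hx ⟨w, hw⟩).symm⟩
  · rintro ⟨x, hx⟩
    exact ⟨x, funext fun w => (hx w.1 w.2).symm⟩

variable (t) in
/-- The restriction homomorphisms of the group of locally coherent sequences. -/
noncomputable def resHom (v : t.J) : t.locallyCoherent →* (t.wordHom v).range :=
  ((t.restr v).comp t.locallyCoherent.subtype).codRestrict _ fun k =>
    Subgroup.mem_iInf.1 k.2 v

variable (t) in
/-- The disjoint union of the groups of coherent sequences below the elements of `J`. -/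
structure Carrier : Type u where
  index : t.J
  val : (t.wordHom index).range

/-- Locally coherent sequences act by left multiplication. -/
noncomputable instance : MulAction t.locallyCoherent t.Carrier where
  smul k x := ⟨x.1, t.resHom x.1 k * x.2⟩
  one_smul x := by
    change (⟨x.1, t.resHom x.1 1 * x.2⟩ : t.Carrier) = x
    rw [map_one, one_mul]
  mul_smul k k' x := by
    change (⟨x.1, t.resHom x.1 (k * k') * x.2⟩ : t.Carrier)
      = ⟨x.1, t.resHom x.1 k * (t.resHom x.1 k' * x.2)⟩
    rw [map_mul, mul_assoc]

theorem smul_mk (k : t.locallyCoherent) (v : t.J) (x : (t.wordHom v).range) :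
    k • (⟨v, x⟩ : t.Carrier) = ⟨v, t.resHom v k * x⟩ := rfl

theorem mk_carrier_le {κ : Cardinal.{u}} (hκ : Cardinal.aleph0 ≤ κ) (ht : t.IsKappa κ) :
    Cardinal.mk t.Carrier ≤ κ := by
  have hV : ∀ v, Cardinal.mk (t.wordHom v).range ≤ κ := by
    intro v
    have hO : Cardinal.mk (Option (t.I v)) ≤ κ := by
      rw [Cardinal.mk_option]
      exact Cardinal.add_le_of_le hκ (ht.2 v) (Cardinal.one_le_aleph0.trans hκ)
    have hLs : Cardinal.mk (Letter (Option (t.I v))) ≤ κ := by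
      rw [Cardinal.mk_option, Cardinal.mk_prod]
      refine Cardinal.add_le_of_le hκ ?_ (Cardinal.one_le_aleph0.trans hκ)
      refine Cardinal.mul_le_of_le hκ ?_ ?_
      · rw [Cardinal.lift_uzero]
        exact (Cardinal.mk_list_le_max _).trans (max_le hκ hO)
      · exact (Cardinal.lift_le_aleph0.2 Cardinal.mk_le_aleph0).trans hκ
    refine Cardinal.mk_range_le.trans ?_
    rw [Cardinal.mk_freeGroup]
    exact max_le hLs hκ
  have e : t.Carrier ≃ Σ v, (t.wordHom v).range :=
    ⟨fun x => ⟨x.1, x.2⟩, fun x => ⟨x.1, x.2⟩, fun _ => rfl, fun _ => rfl⟩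
  rw [Cardinal.mk_congr e, Cardinal.mk_sigma]
  refine (Cardinal.sum_le_mk_mul_iSup _).trans (Cardinal.mul_le_of_le hκ ht.1 ?_)
  exact ciSup_le' hV

instance : FaithfulSMul t.locallyCoherent t.Carrier where
  eq_of_smul_eq_smul {k k'} e := by
    apply Subtype.ext
    funext v
    have e' := e ⟨v, 1⟩
    rw [smul_mk, smul_mk, Carrier.mk.injEq] at e'
    have e'' := eq_of_heq e'.2
    rw [mul_one, mul_one] at e''
    exact congrFun (congrArg Subtype.val e'') ⟨v, le_rfl⟩

/-- The action is closed: a permutation that agrees with group elements on pairs of points is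
determined by the images of the points `⟨v, 1⟩`, and these fit together into one locally coherent
sequence. -/
theorem isKappaAutGroup_locallyCoherent {κ : Cardinal.{u}} (hκ : Cardinal.aleph0 ≤ κ)
    (ht : t.IsKappa κ) : IsKappaAutGroup κ t.locallyCoherent := by
  refine isKappaAutGroup_of_closed (M := t.Carrier) (mk_carrier_le hκ ht) ?_
  intro σ hσ
  have h₂ : ∀ x y, ∃ k : t.locallyCoherent, σ x = k • x ∧ σ y = k • y := by
    intro x y
    obtain ⟨k, hk⟩ := hσ 2 ![x, y]
    exact ⟨k, hk 0, hk 1⟩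
  have h₁ : ∀ v, ∃ c : (t.wordHom v).range, σ ⟨v, 1⟩ = ⟨v, c⟩ := by
    intro v
    obtain ⟨k, hk, -⟩ := h₂ ⟨v, 1⟩ ⟨v, 1⟩
    exact ⟨_, hk⟩
  choose c hc using h₁
  have hres : ∀ v (k : t.locallyCoherent), σ ⟨v, 1⟩ = k • (⟨v, 1⟩ : t.Carrier) →
      c v = t.resHom v k := by
    intro v k hk
    rw [hc, smul_mk, mul_one, Carrier.mk.injEq] at hk
    exact eq_of_heq hk.2
  have hcoh : ∀ v (w : {w : t.J // w ≤ v}), (c v).1 w = (c w.1).1 ⟨w.1, le_rfl⟩ := by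
    intro v w
    obtain ⟨k, hv, hw⟩ := h₂ ⟨v, 1⟩ ⟨w.1, 1⟩
    rw [hres v k hv, hres w.1 k hw]
    rfl
  let k : t.locallyCoherent := ⟨fun w => (c w).1 ⟨w, le_rfl⟩, by
    rw [locallyCoherent, Subgroup.mem_iInf]
    intro v
    have : t.restr v (fun w => (c w).1 ⟨w, le_rfl⟩) = (c v).1 := funext fun w => (hcoh v w).symm
    rw [Subgroup.mem_comap, this]
    exact (c v).2⟩
  refine ⟨k, ?_⟩
  rintro ⟨v, x⟩
  obtain ⟨k', hv, hx⟩ := h₂ ⟨v, 1⟩ ⟨v, x⟩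
  rw [hx, smul_mk, smul_mk, ← hres v k' hv]
  congr 2
  exact Subtype.ext (funext fun w => hcoh v w)

end Powis

end AutTower

namespace AutTower

/-! ### Locally coherent sequences come from the limit -/

namespace Aleph1Directed

variable {J : Type u} [PartialOrder J]

/-- Countably many classes: one of them is cofinal. -/
theorem exists_cofinal (hJ : Aleph1Directed J) {ι : Type*} [Countable ι] (R : J → ι → Prop)
    (hR : ∀ v, ∃ w, v ≤ w ∧ ∃ i, R w i) : ∃ i, ∀ v, ∃ w, v ≤ w ∧ R w i := by
  by_contra hcon
  push Not at hcon
  choose b hb using hcon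
  obtain ⟨c, hc⟩ := hJ (Set.range b) (Set.countable_range b)
  obtain ⟨w, hw, i, hi⟩ := hR c
  exact hb i w ((hc _ ⟨i, rfl⟩).trans hw) hi

end Aleph1Directed

namespace Powis

variable {t : Powis.{u}}

/-- Between `lo` and `hi` the sequence `k` is given by the word `σ` in the parameters `s`. -/
def Represents (k : ∀ v, K (t.I v)) (lo hi : t.J) {n : ℕ} (σ : Wrd (Option (Fin n)))
    (s : Fin n → Option (t.I hi)) : Prop :=
  ∀ (v : t.J) (_ : lo ≤ v) (hv : v ≤ hi), k v = ev (t.I v) (subst (strict (t.piHat hv ∘ s)) σ)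

theorem Represents.project {k : ∀ v, K (t.I v)} {lo hi : t.J} {n : ℕ} {σ : Wrd (Option (Fin n))}
    {s : Fin n → Option (t.I hi)} (hs : Represents k lo hi σ s) {mid : t.J} (hm : mid ≤ hi) :
    Represents k lo mid σ (t.piHat hm ∘ s) := by
  intro v hlo hv
  rw [hs v hlo (hv.trans hm), ← Function.comp_assoc, piHat_comp]

theorem Represents.mono {k : ∀ v, K (t.I v)} {lo lo' hi : t.J} {n : ℕ} {σ : Wrd (Option (Fin n))}
    {s : Fin n → Option (t.I hi)} (hs : Represents k lo hi σ s) (hl : lo ≤ lo') :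
    Represents k lo' hi σ s :=
  fun v hlo hv => hs v (hl.trans hlo) hv

theorem Represents.drop {k : ∀ v, K (t.I v)} {lo hi : t.J} {n : ℕ}
    {σ : Wrd (Option (Fin (n + 1)))} {s : Fin (n + 1) → Option (t.I hi)}
    (hs : Represents k lo hi σ s) (i : Fin (n + 1)) (hi' : s i = none) :
    Represents k lo hi (subst (strict (finSuccEquiv' i)) σ) (s ∘ i.succAbove) := by
  intro v hlo hv
  rw [hs v hlo hv, ← subst_strict_drop (t.piHat hv ∘ s) i (by simp [hi', piHat])]
  rfl

/-- There are only countably many shapes, so one of them occurs at cofinally many indices;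
projecting the parameters down carries it to all indices. -/
theorem exists_represents (hJ : Aleph1Directed t.J) {k : ∀ v, K (t.I v)}
    (hk : k ∈ t.locallyCoherent) : ∃ (n : ℕ) (σ : Wrd (Option (Fin n))) (lo : t.J),
      ∀ v, lo ≤ v → ∃ s : Fin n → Option (t.I v), Represents k lo v σ s := by
  obtain ⟨lo⟩ := t.nonempty_J
  have hex : ∀ v, ∃ w, v ≤ w ∧ ∃ p : Σ n, Wrd (Option (Fin n)),
      ∃ s : Fin p.1 → Option (t.I w), Represents k lo w p.2 s := by
    intro v
    obtain ⟨x, hx⟩ := mem_locallyCoherent.1 hk v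
    obtain ⟨n, s, σ, rfl⟩ := exists_strict_shape x
    refine ⟨v, le_rfl, ⟨n, σ⟩, s, fun w _ hw => ?_⟩
    rw [hx w hw, subst_subst, comp_strict]
    rfl
  obtain ⟨⟨n, σ⟩, hp⟩ := hJ.exists_cofinal _ hex
  refine ⟨n, σ, lo, fun v _ => ?_⟩
  obtain ⟨w, hw, s, hs⟩ := hp v
  exact ⟨_, hs.project hw⟩

/-- A locally coherent sequence is represented by a single word with parameters all of whose
projections, down to a fixed index, are defined. -/
theorem exists_represents_total (hJ : Aleph1Directed t.J) {k : ∀ v, K (t.I v)}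
    (hk : k ∈ t.locallyCoherent) : ∃ (n : ℕ) (σ : Wrd (Option (Fin n))) (lo : t.J),
      ∀ v, lo ≤ v → ∃ s : Fin n → t.I v, Represents k lo v σ (fun i => some (s i)) ∧
        ∀ (w : t.J) (_ : lo ≤ w) (hw : w ≤ v) (i : Fin n), ∃ a, t.π hw (s i) = some a := by
  classical
  have hex := exists_represents hJ hk
  have hmin := fun m (hm : m < Nat.find hex) => Nat.find_min hex hm
  obtain ⟨σ, lo, hlo⟩ := Nat.find_spec hex
  revert hmin σ lo hlo
  generalize Nat.find hex = n
  intro hmin σ lo hlo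
  by_contra hcon
  -- With `n` minimal, failure of the claim yields cofinally many representations with an undefined
  -- entry. Its position can be taken constant, and dropping it contradicts minimality.
  have hbad : ∀ w, ∃ w', w ≤ w' ∧ ∃ i : Fin n, ∃ hl : lo ≤ w',
      ∃ s : Fin n → Option (t.I w'), Represents k lo w' σ s ∧ s i = none := by
    intro w₀
    obtain ⟨w, hw₀, hlw⟩ := t.directed w₀ lo
    refine ⟨w, hw₀, ?_⟩
    by_contra hno
    push Not at hno
    refine hcon ⟨n, σ, w, fun v hv => ?_⟩
    obtain ⟨s, hs⟩ := hlo v (hlw.trans hv)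
    have hdef : ∀ i, t.piHat hv (s i) ≠ none := fun i => hno i hlw _ (hs.project hv)
    have hsne : ∀ i, s i ≠ none := fun i e => hdef i (by rw [e]; rfl)
    choose c hc using fun i => Option.ne_none_iff_exists'.1 (hsne i)
    have hsc : s = fun i => some (c i) := funext hc
    subst hsc
    refine ⟨c, hs.mono hlw, fun u hu huv i => ?_⟩
    refine Option.ne_none_iff_exists'.1 fun e => hdef i ?_
    rw [← t.piHat_piHat hu huv]
    exact congrArg (t.piHat hu) e
  obtain ⟨i, hi⟩ := hJ.exists_cofinal _ hbad
  cases n with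
  | zero => exact i.elim0
  | succ n =>
    refine hmin n (Nat.lt_succ_self n) ⟨subst (strict (finSuccEquiv' i)) σ, lo, fun v _ => ?_⟩
    obtain ⟨w, hw, _, s, hs, hsi⟩ := hi v
    exact ⟨_, (hs.drop i hsi).project hw⟩

/-- The supports of a locally coherent sequence are cofinally often given by finitely many
coherent sequences of elements. -/
theorem exists_coherent_support (hJ : Aleph1Directed t.J) {k : ∀ v, K (t.I v)} {n : ℕ}
    {σ : Wrd (Option (Fin n))} {lo : t.J}
    (hrep : ∀ v, lo ≤ v → ∃ s : Fin n → t.I v, Represents k lo v σ fun i => some (s i)) :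
    ∃ (m : ℕ) (τ : Wrd (Option (Fin m))) (lo' : t.J) (r : Fin m → ∀ v, lo' ≤ v → t.I v),
      (∀ j (v₁ v₂ : t.J) (h₁ : lo' ≤ v₁) (h₁₂ : v₁ ≤ v₂),
        t.π h₁₂ (r j v₂ (h₁.trans h₁₂)) = some (r j v₁ h₁)) ∧
      ∀ v, ∃ w, v ≤ w ∧ ∃ hw : lo' ≤ w,
        k w = ev (t.I w) (subst (strict fun j => some (r j w hw)) τ) := by
  classical
  choose s hs using hrep
  have := t.nonempty_J
  have : IsDirectedOrder t.J := ⟨t.directed⟩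
  let U : Ultrafilter t.J := Ultrafilter.of Filter.atTop
  have hU : ∀ u, ∀ᶠ w in (U : Filter t.J), u ≤ w := fun u =>
    Ultrafilter.of_le Filter.atTop (Filter.eventually_ge_atTop u)
  -- The support of `k u` is contained in the projection to `u` of every `s w` with `w` above `u`.
  -- The ultrafilter picks positions `φ` in `s w` valid for almost all `w`, leaving only countably
  -- many possible data `(m, τ, φ)`.
  let R : t.J → (Σ m : ℕ, Wrd (Option (Fin m)) × (Fin m → Fin n)) → Prop := fun u p =>
    ∃ (hu : lo ≤ u) (c : Fin p.1 → t.I u),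
      k u = ev (t.I u) (subst (strict fun j => some (c j)) p.2.1) ∧
      ∀ᶠ w in (U : Filter t.J), ∀ hw : u ≤ w, ∀ j, t.π hw (s w (hu.trans hw) (p.2.2 j)) = some (c j)
  have hR : ∀ v, ∃ u, v ≤ u ∧ ∃ p, R u p := by
    intro v
    obtain ⟨u, hvu, hu⟩ := t.directed v lo
    obtain ⟨m, c, τ, hc, hsup⟩ := exists_support (k u)
    have hφ : ∀ᶠ w in (U : Filter t.J), ∃ φ : Fin m → Fin n, ∀ hw : u ≤ w, ∀ j,
        t.π hw (s w (hu.trans hw) (φ j)) = some (c j) := by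
      filter_upwards [hU u] with w hw
      choose φ hφ using hsup n _ σ (hs w (hu.trans hw) u hu hw).symm
      exact ⟨φ, fun _ => hφ⟩
    obtain ⟨φ, hφ⟩ := Ultrafilter.eventually_exists_iff.1 hφ
    exact ⟨u, hvu, ⟨m, τ, φ⟩, hu, c, hc.symm, hφ⟩
  obtain ⟨⟨m, τ, φ⟩, hcof⟩ := hJ.exists_cofinal R hR
  choose hlo c hkc hπ using fun (u : {u // R u ⟨m, τ, φ⟩}) => u.2
  have hcoh : ∀ (u v : {u // R u ⟨m, τ, φ⟩}) (huv : u.1 ≤ v.1) j,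
      t.π huv (c v j) = some (c u j) := by
    intro u v huv j
    -- Both supports are projections of the same entries `φ j` of a common `s w`, hence cohere.
    obtain ⟨w, hw₁, hw₂, hw₃⟩ := ((hπ u).and ((hπ v).and (hU v.1))).exists
    have e₁ := hw₁ (huv.trans hw₃) j
    have e₂ := hw₂ hw₃ j
    rwa [t.π_comp huv hw₃, e₂] at e₁
  obtain ⟨lo'⟩ := t.nonempty_J
  obtain ⟨u₀, -, hu₀⟩ := hcof lo'
  have hthread : ∀ j v, u₀ ≤ v → ∃ a, ∀ (u : {u // R u ⟨m, τ, φ⟩}) (hvu : v ≤ u.1),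
      t.π hvu (c u j) = some a := by
    intro j v hv
    obtain ⟨u₁, hvu₁, hu₁⟩ := hcof v
    have e := hcoh ⟨u₀, hu₀⟩ ⟨u₁, hu₁⟩ (hv.trans hvu₁) j
    rw [t.π_comp hv hvu₁] at e
    obtain ⟨a, ha, -⟩ := Option.bind_eq_some_iff.1 e
    refine ⟨a, fun u hvu => ?_⟩
    obtain ⟨z, hz₁, hz₂⟩ := t.directed u₁ u.1
    obtain ⟨z', hz', hzR⟩ := hcof z
    have a₁ := t.π_comp hvu₁ (hz₁.trans hz') (c ⟨z', hzR⟩ j)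
    have a₂ := t.π_comp hvu (hz₂.trans hz') (c ⟨z', hzR⟩ j)
    rw [hcoh ⟨u₁, hu₁⟩ ⟨z', hzR⟩ (hz₁.trans hz') j] at a₁
    rw [hcoh u ⟨z', hzR⟩ (hz₂.trans hz') j] at a₂
    exact a₂.symm.trans (a₁.trans ha)
  choose r hr using hthread
  refine ⟨m, τ, u₀, r, ?_, ?_⟩
  · intro j v₁ v₂ h₁ h₁₂
    obtain ⟨u, hu, huR⟩ := hcof v₂
    have e := hr j v₁ h₁ ⟨u, huR⟩ (h₁₂.trans hu)
    rwa [t.π_comp h₁₂ hu, hr j v₂ (h₁.trans h₁₂) ⟨u, huR⟩ hu] at e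
  · intro v
    obtain ⟨z, hz₁, hz₂⟩ := t.directed v u₀
    obtain ⟨u, hu, huR⟩ := hcof z
    refine ⟨u, hz₁.trans hu, hz₂.trans hu, ?_⟩
    -- `π` from `u` to `u` is not assumed to be the identity, but by `hcoh` it fixes the supports.
    have hrc : ∀ j, r j u (hz₂.trans hu) = c ⟨u, huR⟩ j := fun j =>
      Option.some_injective _
        ((hr j u _ ⟨u, huR⟩ le_rfl).symm.trans (hcoh ⟨u, huR⟩ ⟨u, huR⟩ le_rfl j))
    simp only [hrc]
    exact hkc ⟨u, huR⟩

end Powis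

/-! ### Words over the limit order, and the quotient by eventually trivial sequences -/

namespace Extension

variable {s t : Powis.{u}} {vs : s.J} (E : Extension s t vs)

theorem proj_comp {v w : t.J} (hvw : v ≤ w) (x : s.I vs) :
    E.proj v x = (E.proj w x).bind (t.π hvw) := by
  unfold proj
  rw [s.π_comp (E.j.monotone hvw) (E.le_vs (E.j w)) x]
  cases e : s.π (E.le_vs (E.j w)) x with
  | none => rfl
  | some y =>
    obtain ⟨y, rfl⟩ := (E.ι w).surjective y
    simp only [Option.bind_some, E.π_eq hvw y, Option.map_map, Option.map_some,
      OrderIso.symm_apply_apply]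
    have : (E.ι v).symm ∘ E.ι v = id := funext fun a => (E.ι v).symm_apply_apply a
    rw [this, Option.map_id, id]

/-- The projections of a value in `K_{I_{v_*}}`, as a locally coherent sequence. -/
noncomputable def wordSeq : Wrd (Option (s.I vs)) →* t.locallyCoherent :=
  MonoidHom.mk' (fun x => ⟨fun v => ev (t.I v) (subst (strict (E.proj v)) x),
    Powis.mem_locallyCoherent.2 fun v => ⟨subst (strict (E.proj v)) x, fun w hw => by
      rw [subst_subst]
      congr 3
      funext o
      cases o with
      | none => rfl
      | some a => exact E.proj_comp hw a⟩⟩) fun x y => by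
    apply Subtype.ext
    funext v
    simp only [map_mul, Subgroup.coe_mul, Pi.mul_apply]

theorem wordSeq_apply (x : Wrd (Option (s.I vs))) (v : t.J) :
    (E.wordSeq x).1 v = ev (t.I v) (subst (strict (E.proj v)) x) := rfl

/-- Projections that agree cofinally agree everywhere, and then uniqueness of limits of coherent
sequences applies. -/
theorem IsLimit.eventually_ne {E : Extension s t vs} (hE : E.IsLimit) {x y : s.I vs}
    (hxy : x ≠ y) : ∃ w : t.J, ∀ v, w ≤ v → E.proj v x ≠ E.proj v y := by
  by_contra hcon
  push Not at hcon
  obtain ⟨w, hw⟩ := hE.dom x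
  have heq : ∀ v, E.proj v x = E.proj v y := by
    intro v
    obtain ⟨v', hv', e⟩ := hcon v
    rw [E.proj_comp hv', E.proj_comp hv', e]
  choose r hr using hw
  obtain ⟨z, -, hz⟩ := hE.thread w r (by
    intro v₁ v₂ h₁ h₁₂
    have := E.proj_comp h₁₂ x
    rw [hr v₁ h₁, hr v₂ (h₁.trans h₁₂)] at this
    exact this.symm)
  exact hxy ((hz x hr).trans (hz y fun v hv => (heq v).symm.trans (hr v hv)).symm)

/-- For all large enough `v`, finite tuples in `I_{v_*}` have the same quantifier free type as
their projections. -/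
theorem IsLimit.exists_same_type {E : Extension s t vs} (hE : E.IsLimit)
    (hdir : Aleph1Directed t.J) {n : ℕ} (a : Fin n → s.I vs) :
    ∃ w : t.J, ∀ v, w ≤ v → ∃ a' : Fin n → t.I v, (∀ i, E.proj v (a i) = some (a' i)) ∧
      (∀ i j, a i < a j ↔ a' i < a' j) ∧ ∀ i j, a i = a j ↔ a' i = a' j := by
  have h₁ : ∀ p : Fin n × Fin n, ∃ w : t.J, ∀ v, w ≤ v → ∃ x' y' : t.I v,
      E.proj v (a p.1) = some x' ∧ E.proj v (a p.2) = some y' ∧ (a p.1 < a p.2 ↔ x' < y') :=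
    fun p => hE.order _ _
  have h₂ : ∀ p : Fin n × Fin n, ∃ w : t.J, ∀ v, w ≤ v → a p.1 ≠ a p.2 →
      E.proj v (a p.1) ≠ E.proj v (a p.2) := by
    intro p
    by_cases hp : a p.1 = a p.2
    · obtain ⟨w⟩ := t.nonempty_J
      exact ⟨w, fun v _ hne => absurd hp hne⟩
    · obtain ⟨w, hw⟩ := hE.eventually_ne hp
      exact ⟨w, fun v hv _ => hw v hv⟩
  choose w₁ hw₁ using h₁
  choose w₂ hw₂ using h₂
  obtain ⟨w, hw⟩ := hdir (Set.range w₁ ∪ Set.range w₂)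
    ((Set.countable_range w₁).union (Set.countable_range w₂))
  refine ⟨w, fun v hv => ?_⟩
  have hw₁' : ∀ p, w₁ p ≤ v := fun p => (hw _ (Or.inl ⟨p, rfl⟩)).trans hv
  have hw₂' : ∀ p, w₂ p ≤ v := fun p => (hw _ (Or.inr ⟨p, rfl⟩)).trans hv
  have hdef : ∀ i, ∃ x', E.proj v (a i) = some x' := by
    intro i
    obtain ⟨x', -, hx', -⟩ := hw₁ (i, i) v (hw₁' _)
    exact ⟨x', hx'⟩
  choose a' ha' using hdef
  refine ⟨a', ha', fun i j => ?_, fun i j => ⟨fun e => ?_, fun e => ?_⟩⟩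
  · obtain ⟨x', y', hx, hy, hlt⟩ := hw₁ (i, j) v (hw₁' _)
    rw [ha' i] at hx
    rw [ha' j] at hy
    cases hx
    cases hy
    exact hlt
  · have := ha' i
    rw [e, ha' j] at this
    exact (Option.some_injective _ this).symm
  · by_contra hne
    exact hw₂ (i, j) v (hw₂' _) hne ((ha' i).trans ((congrArg some e).trans (ha' j).symm))

theorem IsLimit.wordSeq_eventually_one {E : Extension s t vs} (hE : E.IsLimit)
    (hdir : Aleph1Directed t.J) (x : Wrd (Option (s.I vs))) :
    ev _ x = 1 ↔ ∃ w : t.J, ∀ v, w ≤ v → (E.wordSeq x).1 v = 1 := by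
  obtain ⟨n, a, σ, rfl⟩ := exists_total_shape x
  obtain ⟨w, hw⟩ := hE.exists_same_type hdir a
  have key : ∀ v, w ≤ v → (ev _ (subst (strict fun i => some (a i)) σ) = 1 ↔
      (E.wordSeq (subst (strict fun i => some (a i)) σ)).1 v = 1) := by
    intro v hv
    obtain ⟨a', ha, hlt, heq⟩ := hw v hv
    have e : (strict (E.proj v) ∘ strict fun i => some (a i)) = strict fun i => some (a' i) := by
      rw [comp_strict _ rfl]
      congr 1
      funext i
      exact ha i
    rw [wordSeq_apply, subst_subst, e]
    constructor
    · intro h1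
      have := ev_eq_of_same_type hlt heq (w := σ) (w' := 1) (by simpa using h1)
      simpa using this
    · intro h1
      have := ev_eq_of_same_type (fun i j => (hlt i j).symm) (fun i j => (heq i j).symm)
        (w := σ) (w' := 1) (by simpa using h1)
      simpa using this
  constructor
  · intro h1
    exact ⟨w, fun v hv => (key v hv).1 h1⟩
  · rintro ⟨w', hw'⟩
    obtain ⟨v, h₁, h₂⟩ := t.directed w w'
    exact (key v h₁).2 (hw' v h₂)

/-- Every locally coherent sequence is eventually the sequence of projections of a word with
parameters in `I_{v_*}`. -/
theorem IsExistential.exists_eventually_eq {E : Extension s t vs} (hE : E.IsLimit)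
    (hex : E.IsExistential) (hdir : Aleph1Directed t.J) (k : t.locallyCoherent) :
    ∃ (x : Wrd (Option (s.I vs))) (w : t.J), ∀ v, w ≤ v → k.1 v = (E.wordSeq x).1 v := by
  classical
  obtain ⟨n, σ, lo, hrep⟩ := Powis.exists_represents_total hdir k.2
  obtain ⟨m, τ, lo', r, hr, hkr⟩ := Powis.exists_coherent_support hdir (k := k.1) (σ := σ)
    (lo := lo) fun v hv => (hrep v hv).imp fun _ h => h.1
  choose x hx using fun j => (hE.thread lo' (r j) (hr j)).exists
  obtain ⟨us, hlo, hlo'⟩ := t.directed lo lo'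
  let wτ : Wrd (Option (Fin (m + n))) := subst (Option.map (Fin.castAdd n)) τ
  let wσ : Wrd (Option (Fin (m + n))) := subst (Option.map (Fin.natAdd m)) σ
  -- `P` says of a type that `τ` in the first `m` entries and `σ` in the last `n` have the same
  -- value; any realisation of the type gives the same answer.
  let P : QfType.{u} (m + n) → Prop := fun p =>
    ∃ (I : Type u) (_ : PartialOrder I) (c : Fin (m + n) → I), tp c = p ∧
      ev I (subst (strict fun i => some (c i)) wτ) = ev I (subst (strict fun i => some (c i)) wσ)
  have hP : ∀ (v : t.J) (a : Fin m → t.I v) (b : Fin n → t.I v), P (tp (Fin.append a b)) ↔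
      ev (t.I v) (subst (strict fun i => some (a i)) τ)
        = ev (t.I v) (subst (strict fun i => some (b i)) σ) := by
    intro v a b
    have e₁ : subst (strict fun i => some (Fin.append a b i)) wτ
        = subst (strict fun i => some (a i)) τ := by
      rw [subst_subst]
      congr 2
      funext o
      cases o <;> simp
    have e₂ : subst (strict fun i => some (Fin.append a b i)) wσ
        = subst (strict fun i => some (b i)) σ := by
      rw [subst_subst]
      congr 2
      funext o
      cases o <;> simp
    rw [← e₁, ← e₂]
    constructor
    · rintro ⟨I, _, c, hc, e⟩
      exact (ev_eq_of_tp_eq hc _ _).1 e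
    · intro e
      exact ⟨_, _, _, rfl, e⟩
  let R : Setoid (QfType.{u} (m + n)) :=
    ⟨fun p q => P p ↔ P q, fun _ => Iff.rfl, fun h => h.symm, fun h h' => h.trans h'⟩
  -- Since `σ` computes `k` at `w` whatever the `v` from which the parameters are projected, the
  -- class at `w` does not depend on `v`.
  have hPk : ∀ (v w : t.J) (hw : us ≤ w) (hwv : w ≤ v) (b : Fin n → t.I v)
      (_ : Powis.Represents k.1 lo v σ fun i => some (b i)) (b' : Fin n → t.I w)
      (_ : ∀ i, t.π hwv (b i) = some (b' i)),
      (P (tp (Fin.append (fun j => r j w (hlo'.trans hw)) b')) ↔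
        k.1 w = ev (t.I w) (subst (strict fun j => some (r j w (hlo'.trans hw))) τ)) := by
    intro v w hw hwv b hb b' hb'
    rw [hP, hb w (hlo.trans hw) hwv, eq_comm]
    have : (t.piHat hwv ∘ fun i => some (b i)) = fun i => some (b' i) := funext hb'
    rw [this]
  choose b hb hbd using hrep
  -- `b'` is the image of `b` under `π` from `v` to itself, which may differ from `b`.
  choose b' hb' using fun v (hv : us ≤ v) i => hbd v (hlo.trans hv) v (hlo.trans hv) le_rfl i
  obtain ⟨y, p, w₀, hw₀, hy⟩ := hex us m n R
    (fun v hv => Quotient.mk R (tp (Fin.append (fun j => r j v (hlo'.trans hv)) (b' v hv)))) x (by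
      intro v hv
      refine ⟨b v (hlo.trans hv), fun w hw hwv => ?_⟩
      choose c hc using hbd v (hlo.trans hv) w (hlo.trans hw) hwv
      refine ⟨fun j => r j w (hlo'.trans hw), c, fun j => hx j w _, hc, Quotient.sound ?_⟩
      change P _ ↔ P _
      rw [hPk w w hw le_rfl _ (hb w (hlo.trans hw)) _ (hb' w hw),
        hPk v w hw hwv _ (hb v (hlo.trans hv)) _ hc])
  have hPp : ∀ w (hw : us ≤ w), w₀ ≤ w → (P p ↔
      k.1 w = ev (t.I w) (subst (strict fun j => some (r j w (hlo'.trans hw))) τ)) := by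
    intro w hw hw'
    obtain ⟨_, _, -, -, -, e⟩ := hy w hw hw'
    rw [← hPk w w hw le_rfl _ (hb w (hlo.trans hw)) _ (hb' w hw)]
    exact (Quotient.exact e).symm
  -- Of the limit tuple, only the fact that the classes stabilise at that of `p` matters. Cofinally
  -- often the class is that of agreement, so this is the stable one.
  have hp : P p := by
    obtain ⟨w, hw, _, e⟩ := hkr w₀
    exact (hPp w (hw₀.trans hw) hw).2 e
  refine ⟨subst (strict fun j => some (x j)) τ, w₀, fun v hv => ?_⟩
  rw [(hPp v (hw₀.trans hv) hv).1 hp, wordSeq_apply, subst_subst, comp_strict _ rfl]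
  congr 4
  funext j
  exact (hx j v _).symm

/-- The normal subgroup of eventually trivial sequences. -/
def eventuallyOne (t : Powis.{u}) : Subgroup t.locallyCoherent where
  carrier := {k | ∃ w : t.J, ∀ v, w ≤ v → k.1 v = 1}
  mul_mem' := by
    rintro k k' ⟨w, hw⟩ ⟨w', hw'⟩
    obtain ⟨z, hz, hz'⟩ := t.directed w w'
    refine ⟨z, fun v hv => ?_⟩
    rw [Subgroup.coe_mul, Pi.mul_apply, hw v (hz.trans hv), hw' v (hz'.trans hv), one_mul]
  one_mem' := by
    obtain ⟨w⟩ := t.nonempty_J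
    exact ⟨w, fun _ _ => rfl⟩
  inv_mem' := by
    rintro k ⟨w, hw⟩
    refine ⟨w, fun v hv => ?_⟩
    rw [Subgroup.coe_inv, Pi.inv_apply, hw v hv, inv_one]

instance (t : Powis.{u}) : (eventuallyOne t).Normal where
  conj_mem := by
    rintro k ⟨w, hw⟩ k'
    refine ⟨w, fun v hv => ?_⟩
    rw [Subgroup.coe_mul, Subgroup.coe_mul, Pi.mul_apply, Pi.mul_apply, hw v hv, Subgroup.coe_inv,
      Pi.inv_apply, mul_one, mul_inv_cancel]

/-- By linearity, a sequence that is `1` from `w` on is determined by `w` and its restriction below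
`w`, which is a point of `t.Carrier`. -/
theorem mk_eventuallyOne_le {t : Powis.{u}} {κ : Cardinal.{u}} (hκ : Cardinal.aleph0 ≤ κ)
    (hlin : ∀ v w : t.J, v ≤ w ∨ w ≤ v) (ht : t.IsKappa κ) :
    Cardinal.mk (eventuallyOne t) ≤ κ := by
  choose w hw using fun k : eventuallyOne t => k.2
  refine le_trans (Cardinal.mk_le_of_injective
    (f := fun k => (⟨w k, t.resHom (w k) k.1⟩ : t.Carrier)) ?_) (Powis.mk_carrier_le hκ ht)
  intro k k' e
  have hval : ∀ x y : t.Carrier, x = y → ∀ v (hx : v ≤ x.1) (hy : v ≤ y.1),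
      x.2.1 ⟨v, hx⟩ = y.2.1 ⟨v, hy⟩ := by
    rintro x _ rfl v _ _
    rfl
  have hidx : w k = w k' := congrArg Powis.Carrier.index e
  apply Subtype.ext
  apply Subtype.ext
  funext v
  rcases hlin v (w k) with hv | hv
  · exact hval _ _ e v hv (hv.trans_eq hidx)
  · rw [hw k v hv, hw k' v (hidx ▸ hv)]

/-- Both groups are quotients of the free group of words over `s.I vs`, with the same kernel. -/
theorem nonempty_mulEquiv {E : Extension s t vs} (hE : E.IsLimit)
    (hex : E.IsExistential) (hdir : Aleph1Directed t.J) :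
    Nonempty (K (s.I vs) ≃* t.locallyCoherent ⧸ eventuallyOne t) := by
  let q := (QuotientGroup.mk' (eventuallyOne t)).comp E.wordSeq
  have hq : Function.Surjective q := by
    intro a
    obtain ⟨k, rfl⟩ := QuotientGroup.mk'_surjective _ a
    obtain ⟨x, w, hw⟩ := hex.exists_eventually_eq hE hdir k
    refine ⟨x, QuotientGroup.eq.2 ⟨w, fun v hv => ?_⟩⟩
    rw [Subgroup.coe_mul, Subgroup.coe_inv, Pi.mul_apply, Pi.inv_apply, hw v hv, inv_mul_cancel]
  have hker : (ev (s.I vs)).ker = q.ker := by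
    ext x
    rw [MonoidHom.mem_ker, MonoidHom.mem_ker, hE.wordSeq_eventually_one hdir]
    exact (QuotientGroup.eq_one_iff (N := eventuallyOne t) (E.wordSeq x)).symm
  exact ⟨((QuotientGroup.quotientKerEquivOfSurjective _ ev_surjective).symm.trans
    (QuotientGroup.quotientMulEquivOfEq hker)).trans
    (QuotientGroup.quotientKerEquivOfSurjective q hq)⟩

end Extension

end AutTower

theorem claimp2 (κ : Cardinal.{u}) (hκ : Cardinal.aleph0 ≤ κ)
    (s t : AutTower.Powis.{u}) (vs : s.J)
    (hlim : AutTower.IsExistentialLimit s t vs)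
    (hdir : AutTower.Aleph1Directed t.J)
    (hlin : ∀ v w : t.J, v ≤ w ∨ w ≤ v)
    (ht : t.IsKappa κ)
    (hnt : t.NonTrivial) :
    AutTower.IsAlmostKappaAutGroup κ (AutTower.K (s.I vs)) := by
  obtain ⟨E, hE, hex⟩ := hlim
  exact ⟨t.locallyCoherent, inferInstance, AutTower.Powis.isKappaAutGroup_locallyCoherent hκ ht,
    AutTower.Extension.eventuallyOne t, inferInstance,
    AutTower.Extension.mk_eventuallyOne_le hκ hlin ht,
    AutTower.Extension.nonempty_mulEquiv hE hex hdir⟩
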